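/- All groups are profinite, homomorphisms are continuous, and an epimorphism (written $\twoheadrightarrow$) is a surjective homomorphism. An epimorphism $\varphi\colon H\twoheadrightarrow G$ is \emph{indecomposable} if it is not an isomorphism and whenever $\varphi=\rho\circ\psi$ with epimorphisms $\psi,\rho$ of profinite groups, $\psi$ or $\rho$ is an isomorphism. For $\eta\colon H\twoheadrightarrow G$ and $\eta'\colon H'\twoheadrightarrow G$ write $\eta\cong_G\eta'$ if $\eta=\eta'\circ e$ for some isomorphism $e\colon H\to H'$. A commutative square with maps $\varepsilon\colon X\twoheadrightarrow E$, $\beta\colon X\twoheadrightarrow G$, $\zeta\colon E\twoheadrightarrow D$, $\pi\colon G\twoheadrightarrow D$, $\pi\circ\beta=\zeta\circ\varepsilon$, is \emph{semi-cartesian} (resp. \emph{cartesian}) if for all $g\in G$, $e\in E$ with $\pi(g)=\zeta(e)$ there is an (resp. exactly one) $x\in X$ with $\beta(x)=g$ and $\varepsilon(x)=e$. Let $(\eta_i\colon H_i\twoheadrightarrow G)_{i\in I}$ be a (possibly empty or infinite) family of indecomposable epimorphisms. For $J\subseteq I$ let $H_J$ be the fiber product over $G$ of $(\eta_i)_{i\in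 J}$, with structure map $\eta_J\colon H_J\twoheadrightarrow G$ (so $H_\emptyset=G$, $\eta_\emptyset=\mathrm{id}_G$), and let $\mathrm{pr}_{I,J}\colon H_I\twoheadrightarrow H_J$ and $\mathrm{pr}_{I,j}\colon H_I\twoheadrightarrow H_j$ be the projections. An abelian kernel of an epimorphism onto $G$ is a $G$-module through conjugation by lifts. \textbf{Theorem.} (1) Let $\pi\colon G\twoheadrightarrow D$ be an epimorphism, $\zeta\colon E\twoheadrightarrow D$ an indecomposable epimorphism, and $C=\mathrm{Ker}\,\zeta$. Let $\hat\zeta=\mathrm{Inf}_\pi\zeta$ be the projection $G\times_D E\twoheadrightarrow G$ and $I_{\hat\zeta}=\{i\in I: \eta_i\cong_G\hat\zeta\}$. If $C$ is abelian, let $\hat C=\mathrm{Inf}_\pi C$ be the $D$-module $C$ regarded as a $G$-module via $\pi$, and let $I_{\hat C}=\{i\in I:\mathrm{Ker}\,\eta_i\cong_G\hat C\}$; choose $G$-isomorphisms $\theta_i\colon \mathrm{Ker}\,\eta_i\to\hat C$ for $i\in I_{\hat C}$ and let $[\eta_i]\in H^2(G,\hat C)$ be the resulting extension classes (continuous cohomology).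 Let $[\hat\zeta]\in H^2(G,\hat C)$ be the image of the class of $\zeta$ under the inflation $\mathrm{Inf}_\pi\colon H^2(D,C)\to H^2(G,\hat C)$. Then there is an epimorphism $\varepsilon\colon H_I\twoheadrightarrow E$ such that the square formed by $\varepsilon,\eta_I,\zeta,\pi$ is semi-cartesian (in particular $\pi\circ\eta_I=\zeta\circ\varepsilon$) if and only if exactly one of the following conditions holds: (a) $C$ is non-abelian and $I_{\hat\zeta}\neq\emptyset$; (b) $C$ is abelian, $I_{\hat C}\ne\emptyset$, and $[\hat\zeta]=\sum_{i\in I_{\hat C}}\alpha_i[\eta_i]$ for some $\alpha_i\in\mathrm{End}_G(\hat C)$, all but finitely many zero and not all zero (whatever the choice of the $\theta_i$). Moreover, for every epimorphism $\varepsilon$ for which the square is semi-cartesian: (a') if $C$ is non-abelian, there is a unique $j\in I$ with $\mathrm{Ker}\,\mathrm{pr}_{I,j}=\mathrm{Ker}\,\varepsilon\cap\mathrm{Ker}\,\eta_I$; this $j$ is in $I_{\hat\zeta}$, and there is $\varepsilon_j\colon H_j\twoheadrightarrow E$ such that $\varepsilon=\varepsilon_j\circ\mathrm{pr}_{I,j}$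 and the square formed by $\varepsilon_j,\eta_j,\zeta,\pi$ commutes and is cartesian; (b') if $C$ is abelian, there is $\varepsilon'\colon H_{I_{\hat C}}\twoheadrightarrow E$ with $\varepsilon=\varepsilon'\circ\mathrm{pr}_{I,I_{\hat C}}$. (2) (The case $\pi=\mathrm{id}$.) Let $\zeta\colon E\twoheadrightarrow G$ be indecomposable, $C=\mathrm{Ker}\,\zeta$, $I_\zeta=\{i:\eta_i\cong_G\zeta\}$ and, if $C$ is abelian, $I_C=\{i:\mathrm{Ker}\,\eta_i\cong_G C\}$. There is an epimorphism $\varepsilon\colon H_I\twoheadrightarrow E$ with $\zeta\circ\varepsilon=\eta_I$ if and only if exactly one of the following holds: (a) $C$ is non-abelian and $I_\zeta\ne\emptyset$; (b) $C$ is abelian, $I_C\neq\emptyset$, and the class of $\zeta$ in $H^2(G,C)$ is a (finite) linear combination of the classes $[\eta_i]$, $i\in I_C$, over $\mathrm{End}_G(C)$ with not all coefficients zero. Moreover, for every epimorphism $\varepsilon$ with $\zeta\circ\varepsilon=\eta_I$: (a') if $C$ is non-abelian, there is a unique $j\in I$ with $\mathrm{Ker}\,\varepsilon=\mathrm{Ker}\,\mathrm{pr}_{I,j}$;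 this $j$ is in $I_\zeta$, and there is an isomorphism $\varepsilon_j\colon H_j\to E$ with $\varepsilon_j\circ\mathrm{pr}_{I,j}=\varepsilon$ and $\zeta\circ\varepsilon_j=\eta_j$; (b') if $C$ is abelian, there is $\varepsilon'\colon H_{I_C}\twoheadrightarrow E$ with $\varepsilon=\varepsilon'\circ\mathrm{pr}_{I,I_C}$, and hence $\zeta\circ\varepsilon'=\eta_{I_C}$. -/

import Mathlib

/-! Profinite groups are topological groups that are compact and totally disconnected (hence
Hausdorff), homomorphisms between them are continuous (`→ₜ*`), and an epimorphism is a surjective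
continuous homomorphism. A bijective continuous homomorphism of profinite groups is an isomorphism
of profinite groups. -/

open scoped IsMulCommutative

namespace ProfiniteCover

universe u

/-- An epimorphism `φ : H → G` of profinite groups is indecomposable if it is not an isomorphism and
in each factorization `φ = ρ ∘ ψ` into epimorphisms of profinite groups one of the factors is an
isomorphism. (The middle group is a quotient of `H`, so it may be taken in the universe of `H`.) -/
structure Indecomposable {H : Type u} {G : Type*} [Group H] [TopologicalSpace H]
    [Group G] [TopologicalSpace G] (φ : H →ₜ* G) : Prop where
  surjective : Function.Surjective φ
  not_bijective : ¬ Function.Bijective φ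
  bijective_or_bijective : ∀ (E : Type u) [Group E] [TopologicalSpace E] [IsTopologicalGroup E]
    [CompactSpace E] [TotallyDisconnectedSpace E] (ψ : H →ₜ* E) (ρ : E →ₜ* G),
    Function.Surjective ψ → Function.Surjective ρ → ρ.comp ψ = φ →
      Function.Bijective ψ ∨ Function.Bijective ρ

/-- `η ≅_G η'`: there is an isomorphism `e` of topological groups with `η' ∘ e = η`. -/
def CoverIso {H H' G : Type*} [Group H] [TopologicalSpace H] [Group H'] [TopologicalSpace H']
    [Group G] [TopologicalSpace G] (η : H →ₜ* G) (η' : H' →ₜ* G) : Prop :=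
  ∃ e : H ≃ₜ* H', ∀ h, η' (e h) = η h

/-- The commutative square
```
  H --η--> G
  |        |
  β        φ
  v        v
  B --α--> A
```
is semi-cartesian: all `b`, `g` with `α b = φ g` have a common lift to `H`. -/
structure IsSemiCartesian {H G B A : Type*} [Group H] [TopologicalSpace H]
    [Group G] [TopologicalSpace G] [Group B] [TopologicalSpace B] [Group A] [TopologicalSpace A]
    (η : H →ₜ* G) (β : H →ₜ* B) (φ : G →ₜ* A) (α : B →ₜ* A) : Prop where
  comm : ∀ h, α (β h) = φ (η h)
  exists_lift : ∀ b g, α b = φ g → ∃ h, β h = b ∧ η h = g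

/-- The commutative square of `IsSemiCartesian` is cartesian: all `b`, `g` with `α b = φ g` have
exactly one common lift to `H`. -/
structure IsCartesian {H G B A : Type*} [Group H] [TopologicalSpace H]
    [Group G] [TopologicalSpace G] [Group B] [TopologicalSpace B] [Group A] [TopologicalSpace A]
    (η : H →ₜ* G) (β : H →ₜ* B) (φ : G →ₜ* A) (α : B →ₜ* A) : Prop where
  comm : ∀ h, α (β h) = φ (η h)
  existsUnique_lift : ∀ b g, α b = φ g → ∃! h, β h = b ∧ η h = g

section FiberProduct

variable {I G : Type*} {H : I → Type*} [Group G] [TopologicalSpace G]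
  [∀ i, Group (H i)] [∀ i, TopologicalSpace (H i)]

/-- The fiber product of the family `η i : H i → G`, with the subspace topology. The common image in
`G` is recorded as an extra coordinate, so that the fiber product of the empty family is `G`. -/
def fiberProd (η : ∀ i, H i →ₜ* G) : Subgroup (G × ∀ i, H i) where
  carrier := {x | ∀ i, η i (x.2 i) = x.1}
  mul_mem' {x y} hx hy i := by
    have h1 := hx i
    have h2 := hy i
    simp [h1, h2]
  one_mem' i := by simp
  inv_mem' {x} hx i := by
    have h1 := hx i
    simp [h1]

/-- The structure map `η_I` of the fiber product. -/
def fiberProdMap (η : ∀ i, H i →ₜ* G) : fiberProd η →ₜ* G where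
  toFun x := x.1.1
  map_one' := rfl
  map_mul' _ _ := rfl
  continuous_toFun := by fun_prop

/-- The projection `pr_{I,j}` of the fiber product on the coordinate `j`. -/
def fiberProdProj (η : ∀ i, H i →ₜ* G) (j : I) : fiberProd η →ₜ* H j where
  toFun x := x.1.2 j
  map_one' := rfl
  map_mul' _ _ := rfl
  continuous_toFun := by fun_prop

/-- The projection `pr_{I,J}` of the fiber product on the coordinates in `J`. -/
def fiberProdRestrict (η : ∀ i, H i →ₜ* G) (J : Set I) :
    fiberProd η →ₜ* fiberProd (fun i : J => η i) where
  toFun x := ⟨(x.1.1, fun i => x.1.2 i), fun i => x.2 i⟩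
  map_one' := rfl
  map_mul' _ _ := rfl
  continuous_toFun := by fun_prop

end FiberProduct

section Inflation

variable {G D E : Type*} [Group G] [TopologicalSpace G] [Group D] [TopologicalSpace D]
  [Group E] [TopologicalSpace E]

/-- The fiber product `G ×_D E`. -/
def pullback (π : G →ₜ* D) (ζ : E →ₜ* D) : Subgroup (G × E) where
  carrier := {x | π x.1 = ζ x.2}
  mul_mem' {x y} hx hy := by
    have h1 : π x.1 = ζ x.2 := hx
    have h2 : π y.1 = ζ y.2 := hy
    simp [h1, h2]
  one_mem' := by simp
  inv_mem' {x} hx := by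
    have h1 : π x.1 = ζ x.2 := hx
    simp [h1]

/-- The inflation `Inf_π ζ` of the cover `ζ` of `D` along `π : G → D`, a cover of `G`. -/
def coverInflation (π : G →ₜ* D) (ζ : E →ₜ* D) : pullback π ζ →ₜ* G where
  toFun x := x.1.1
  map_one' := rfl
  map_mul' _ _ := rfl
  continuous_toFun := by fun_prop

end Inflation

/-! `G`-modules are given as representations of `G` over `ℤ`. -/

section KernelModule

variable {H G : Type*} [Group H] [Group G]

/-- The action of `H` by conjugation on an abelian kernel. -/
def conjRep (φ : H →* G) [IsMulCommutative φ.ker] : Representation ℤ H (Additive φ.ker) where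
  toFun h := (MonoidHom.toAdditive (MulAut.conjNormal h : MulAut φ.ker).toMonoidHom).toIntLinearMap
  map_one' := by
    ext x
    simp
  map_mul' g h := by
    ext x
    simp

theorem conjRep_congr (φ : H →* G) [IsMulCommutative φ.ker] {h k : H} (hk : φ h = φ k) :
    conjRep φ h = conjRep φ k := by
  ext x
  have hm : k⁻¹ * h ∈ φ.ker := by simp [MonoidHom.mem_ker, hk]
  have h1 := congrArg Subtype.val (mul_comm' (⟨k⁻¹ * h, hm⟩ : φ.ker) x.toMul)
  have h2 : k⁻¹ * h * (x.toMul : H) = x.toMul * (k⁻¹ * h) := h1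
  change h * (x.toMul : H) * h⁻¹ = k * (x.toMul : H) * k⁻¹
  rw [mul_inv_eq_iff_eq_mul, ← mul_right_inj k⁻¹, ← mul_assoc, h2]
  group

/-- The `G`-module structure on the abelian kernel of an epimorphism `φ : H → G`: if `φ h = g`, then
`g` acts on `φ.ker` as the conjugation `x ↦ h x h⁻¹` (for one `h`, equivalently for all `h`). -/
noncomputable def kerRep (φ : H →* G) (hφ : Function.Surjective φ) [IsMulCommutative φ.ker] :
    Representation ℤ G (Additive φ.ker) where
  toFun g := conjRep φ (Function.surjInv hφ g)
  map_one' := by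
    rw [← map_one (conjRep φ)]
    exact conjRep_congr φ (by simp [Function.surjInv_eq])
  map_mul' g h := by
    rw [← map_mul]
    exact conjRep_congr φ (by simp [Function.surjInv_eq])

theorem kerRep_apply (φ : H →* G) (hφ : Function.Surjective φ) [IsMulCommutative φ.ker] (h : H)
    (x : φ.ker) : kerRep φ hφ (φ h) (Additive.ofMul x) = Additive.ofMul (MulAut.conjNormal h x) :=
  LinearMap.congr_fun (conjRep_congr φ (Function.surjInv_eq hφ (φ h))) (Additive.ofMul x)

/-- An isomorphism of `G`-modules from the kernel of `φ : H → G` (with `φ h` acting as conjugation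
by `h`) to the `G`-module `A` with action `ρ`. -/
structure KerEquiv (φ : H →* G) {A : Type*} [AddCommGroup A] (ρ : Representation ℤ G A)
    extends Additive φ.ker ≃+ A where
  map_conj : ∀ (h : H) (x : φ.ker),
    toFun (Additive.ofMul (MulAut.conjNormal h x)) = ρ (φ h) (toFun (Additive.ofMul x))

/-- The identity of an abelian kernel. -/
noncomputable def KerEquiv.refl (φ : H →* G) (hφ : Function.Surjective φ)
    [IsMulCommutative φ.ker] : KerEquiv φ (kerRep φ hφ) where
  toAddEquiv := AddEquiv.refl _
  map_conj h x := (kerRep_apply φ hφ h x).symm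

/-- The kernel of an indecomposable cover `φ` of `G`, if abelian, as a `G`-module. -/
noncomputable abbrev Indecomposable.kerRep [TopologicalSpace H] [TopologicalSpace G]
    {φ : H →ₜ* G} (hφ : Indecomposable φ) [IsMulCommutative (φ : H →* G).ker] :
    Representation ℤ G (Additive (φ : H →* G).ker) :=
  ProfiniteCover.kerRep (φ : H →* G) hφ.surjective

/-- The set of the indices `i` with `Ker (η i) ≅_G A`. -/
def kerIndex {I : Type*} {H : I → Type*} [∀ i, Group (H i)] [TopologicalSpace G]
    [∀ i, TopologicalSpace (H i)] (η : ∀ i, H i →ₜ* G)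
    {A : Type*} [AddCommGroup A] (ρ : Representation ℤ G A) : Set I :=
  {i | Nonempty (KerEquiv (η i : H i →* G) ρ)}

end KernelModule

/-! Second cohomology of a topological group `G` with coefficients in a discrete `G`-module, through
inhomogeneous continuous (that is, locally constant) cochains. -/

section Cohomology

variable {G : Type*} [Group G] {A : Type*} [AddCommGroup A]

/-- The ring `End_G(A)` of endomorphisms of the `G`-module `A`. -/
abbrev endRing (ρ : Representation ℤ G A) : Subring (Module.End ℤ A) :=
  Subring.centralizer (Set.range ρ)

theorem endRing_comm (ρ : Representation ℤ G A) (a : endRing ρ) (g : G) (x : A) :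
    ρ g (a • x) = a • ρ g x :=
  LinearMap.congr_fun (Subring.mem_centralizer_iff.mp a.2 (ρ g) ⟨g, rfl⟩) x

variable [TopologicalSpace G]

/-- Continuous 2-cocycles. -/
def Z2 (ρ : Representation ℤ G A) : Submodule (endRing ρ) (LocallyConstant (G × G) A) where
  carrier := {f | ∀ σ τ υ : G,
    ρ σ (f (τ, υ)) + f (σ, τ * υ) = f (σ * τ, υ) + f (σ, τ)}
  add_mem' {f g} hf hg σ τ υ := by
    have h1 := hf σ τ υ
    have h2 := hg σ τ υ
    simp only [LocallyConstant.add_apply, map_add]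
    rw [add_add_add_comm, h1, h2, add_add_add_comm]
  zero_mem' σ τ υ := by simp
  smul_mem' a f hf σ τ υ := by
    have h1 := hf σ τ υ
    simp only [LocallyConstant.smul_apply, endRing_comm]
    rw [← smul_add, h1, smul_add]

/-- Continuous 2-coboundaries, that is, coboundaries of continuous 1-cochains. -/
def B2 (ρ : Representation ℤ G A) : Submodule (endRing ρ) (LocallyConstant (G × G) A) where
  carrier := {f | ∃ y : LocallyConstant G A,
    ∀ σ τ : G, f (σ, τ) = ρ σ (y τ) - y (σ * τ) + y σ}
  add_mem' {f g} := by
    rintro ⟨y, hy⟩ ⟨z, hz⟩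
    refine ⟨y + z, fun σ τ => ?_⟩
    simp only [LocallyConstant.add_apply, map_add, hy, hz]
    abel
  zero_mem' := ⟨0, fun σ τ => by simp⟩
  smul_mem' a f := by
    rintro ⟨y, hy⟩
    refine ⟨a • y, fun σ τ => ?_⟩
    simp only [LocallyConstant.smul_apply, endRing_comm, hy, smul_add, smul_sub]

/-- The second cohomology group `H²(G, A)`, as a module over `End_G(A)`. -/
abbrev H2 (ρ : Representation ℤ G A) : Type _ := Z2 ρ ⧸ (B2 ρ).submoduleOf (Z2 ρ)

/-- `x ∈ H²(G, A)` is the class of the epimorphism `φ : H → G` whose kernel is identified with the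
`G`-module `A` by `θ`: for some continuous section `s` of `φ`, the class `x` is represented by the
cocycle `f` with `s σ s τ = f (σ, τ) s (σ τ)`. -/
def IsExtensionClass {H : Type*} [Group H] [TopologicalSpace H] {ρ : Representation ℤ G A}
    (φ : H →ₜ* G) (θ : KerEquiv (φ : H →* G) ρ) (x : H2 ρ) : Prop :=
  ∃ (s : C(G, H)) (hs : ∀ σ, φ (s σ) = σ) (f : Z2 ρ),
    (∀ σ τ, f.1 (σ, τ) = θ.toAddEquiv (Additive.ofMul
      ⟨s σ * s τ * (s (σ * τ))⁻¹, by simp [MonoidHom.mem_ker, hs]⟩)) ∧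
    Submodule.Quotient.mk f = x

variable {D : Type*} [Group D] [TopologicalSpace D]

/-- A `D`-module regarded as a `G`-module via `π : G → D`. -/
def infRep (π : G →ₜ* D) (ρ : Representation ℤ D A) : Representation ℤ G A :=
  MonoidHom.comp ρ (π : G →* D)

/-- A `D`-endomorphism is a `G`-endomorphism. -/
def infEnd (π : G →ₜ* D) (ρ : Representation ℤ D A) : endRing ρ →+* endRing (infRep π ρ) :=
  Subring.inclusion (Subring.centralizer_le _ _ (by rintro _ ⟨g, rfl⟩; exact ⟨π g, rfl⟩))

/-- Inflation of cocycles along `π`: composition with `π`. -/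
def infZ2 (π : G →ₜ* D) (ρ : Representation ℤ D A) : Z2 ρ →ₛₗ[infEnd π ρ] Z2 (infRep π ρ) where
  toFun f := ⟨f.1.comap ⟨Prod.map π π, by fun_prop⟩, fun σ τ υ => by
    have h := f.2 (π σ) (π τ) (π υ)
    simpa [infRep] using h⟩
  map_add' _ _ := rfl
  map_smul' _ _ := rfl

/-- The inflation map `Inf_π : H²(D, A) → H²(G, A)`. -/
def infH2 (π : G →ₜ* D) (ρ : Representation ℤ D A) : H2 ρ →ₛₗ[infEnd π ρ] H2 (infRep π ρ) :=
  Submodule.mapQ _ _ (infZ2 π ρ) (by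
    rintro f ⟨y, hy⟩
    refine ⟨y.comap ⟨π, by fun_prop⟩, fun σ τ => ?_⟩
    have h := hy (π σ) (π τ)
    rw [← map_mul] at h
    exact h)

end Cohomology

/-- `y` is a nontrivial linear combination of the family `x`: a finite linear combination whose
coefficients are not all zero. -/
def IsNontrivialLinearCombination (R : Type*) {M ι : Type*} [Semiring R] [AddCommMonoid M]
    [Module R M] (x : ι → M) (y : M) : Prop :=
  ∃ a : ι →₀ R, a ≠ 0 ∧ Finsupp.linearCombination R x a = y

/-- `y ∈ H²(G, A)` is a nontrivial linear combination over `End_G(A)` of those covers `η i` whose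
kernel is isomorphic to `A`. Here the kernels are identified with `A` by `θ`, so that these covers
have classes `x i ∈ H²(G, A)`. -/
def IsNontrivialCombinationOfCovers {I G : Type*} [Group G] [TopologicalSpace G] {H : I → Type*}
    [∀ i, Group (H i)] [∀ i, TopologicalSpace (H i)] {A : Type*} [AddCommGroup A]
    {ρ : Representation ℤ G A} (η : ∀ i, H i →ₜ* G)
    (θ : ∀ i : kerIndex η ρ, KerEquiv (η i : H i →* G) ρ) (y : H2 ρ) : Prop :=
  ∃ x : kerIndex η ρ → H2 ρ, (∀ i : kerIndex η ρ, IsExtensionClass (η i) (θ i) (x i)) ∧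
    IsNontrivialLinearCombination (endRing ρ) x y

end ProfiniteCover

open ProfiniteCover

open scoped IsMulCommutative
open ProfiniteCover

set_option linter.unusedSectionVars false

/-! An epimorphism of profinite groups is indecomposable exactly when its kernel is a minimal
nontrivial closed normal subgroup (`indecomposable_iff`), and such a kernel is finite
(`Indecomposable.finite_ker`). The kernel of `H_I → G` is the product of the kernels of the `η i`,
so a continuous homomorphism is determined on it by its restrictions to the single factors
(`eq_one_of_forall_fiberProdSingle`). If these take values in a finite group, continuity kills
almost all of them (`finite_setOf_fiberProdSingle`).

Let `ε : H_I → E` be an epimorphism over `G` onto an indecomposable cover with kernel `C`.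
Minimality in `H i` and in `E` forces each `Ker (η i)` to be killed or mapped isomorphically onto
`C` (`fiberProdSingle_trivial_or_range`), and some factor survives. Distinct factors commute. Hence
for non-abelian `C` exactly one factor survives, and `ε` is a projection followed by an isomorphism
`H j ≅ E`.

For abelian `C` the surviving factors are `G`-isomorphic to `C`, and `ε` restricts to endomorphisms
`a i` of `C`. Applying `ε` to a family of continuous sections with cocycles `f i` gives a section of
the cover with cocycle `∑ a i • f i`. Conversely, if the cover has a section `s'` with this cocycle,
write `x_i = u_i(x) s_i(g)` for `x` over `g`; then `x ↦ (∑ a i • u_i(x)) s'(g)` is a homomorphism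
(`exists_hom_of_cocycle`). Its image contains the nonzero submodule `a j • C` for some `j`, hence
all of `C`.

Semi-cartesian squares over `π` amount to epimorphisms onto `G ×_D E` over `G`
(`exists_isSemiCartesian_iff`). The inflated cover is again indecomposable and its class is the
inflated class, so the relative statement follows from the same results applied to it. -/

namespace ProfiniteCover

open Topology Filter

/-! ### Minimal kernels, quotients and factorizations of profinite groups -/

section Profinite

variable {H : Type*} [Group H] [TopologicalSpace H] [IsTopologicalGroup H] [CompactSpace H]
  [TotallyDisconnectedSpace H] {G : Type*} [Group G] [TopologicalSpace G]

theorem exists_openNormalSubgroup_le {U : Set H} (hU : U ∈ 𝓝 (1 : H)) :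
    ∃ N : OpenNormalSubgroup H, (N : Set H) ⊆ U := by
  obtain ⟨V, hVU, hV, h1⟩ := mem_nhds_iff.mp hU
  obtain ⟨N, hN⟩ := ProfiniteGrp.exist_openNormalSubgroup_sub_open_nhds_of_one hV h1
  exact ⟨N, hN.trans hVU⟩

/-- Since `N` is closed, two distinct cosets of `N` stay distinct modulo `N V` for a small open
normal `V`, and the image of the open subgroup `N V` in the quotient is clopen. -/
theorem quotient_totallyDisconnectedSpace (N : Subgroup H) [N.Normal] (hN : IsClosed (N : Set H)) :
    TotallyDisconnectedSpace (H ⧸ N) := by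
  have : TotallySeparatedSpace (H ⧸ N) := by
    refine totallySeparatedSpace_iff_exists_isClopen.mpr fun x y => ?_
    induction x using QuotientGroup.induction_on with | _ x
    induction y using QuotientGroup.induction_on with | _ y
    intro hxy
    have hxy' : x⁻¹ * y ∉ N := fun h => hxy (QuotientGroup.eq.mpr h)
    have hU : {u : H | x⁻¹ * y * u ∉ N} ∈ 𝓝 (1 : H) := by
      refine IsOpen.mem_nhds ?_ (by simpa using hxy')
      exact hN.isOpen_compl.preimage (by fun_prop : Continuous fun u : H => x⁻¹ * y * u)
    obtain ⟨V, hV⟩ := exists_openNormalSubgroup_le hU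
    let W : Subgroup H := N ⊔ V
    have hWo : IsOpen (W : Set H) := Subgroup.isOpen_mono le_sup_right V.isOpen'
    have hyW : x⁻¹ * y ∉ W := by
      intro h
      obtain ⟨n, hn, v, hv, hnv⟩ := Subgroup.mem_sup_of_normal_left.mp h
      refine hV (inv_mem hv) ?_
      simpa [← hnv] using hn
    let W' : Subgroup (H ⧸ N) := W.map (QuotientGroup.mk' N)
    have hWo' : IsOpen (W' : Set (H ⧸ N)) := QuotientGroup.isOpenMap_coe _ hWo
    have hW' : IsClopen (W' : Set (H ⧸ N)) := ⟨W'.isClosed_of_isOpen hWo', hWo'⟩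
    refine ⟨(fun q : H ⧸ N => (x : H ⧸ N)⁻¹ * q) ⁻¹' W', hW'.preimage (by fun_prop), ?_, ?_⟩
    · simp
    · rintro ⟨w, hw, hwy⟩
      have h1 : w⁻¹ * (x⁻¹ * y) ∈ N := QuotientGroup.eq.mp hwy
      exact hyW ((Subgroup.mul_mem_cancel_left W (inv_mem hw)).mp
        (le_sup_left (b := (V : Subgroup H)) h1))
  infer_instance

-- A continuous surjection from a compact space to a Hausdorff space is a quotient map, so the
-- algebraic factorization is automatically continuous.
omit [IsTopologicalGroup H] [TotallyDisconnectedSpace H] in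
theorem exists_factor {K : Type*} [Group K] [TopologicalSpace K] [T2Space G]
    (p : H →ₜ* G) (hp : Function.Surjective p) (ε : H →ₜ* K)
    (h : ∀ x, p x = 1 → ε x = 1) : ∃ ε' : G →ₜ* K, ∀ x, ε' (p x) = ε x := by
  have hq : IsQuotientMap p := IsQuotientMap.of_surjective_continuous hp p.continuous_toFun
  let f : G →* K := MonoidHom.liftOfSurjective (p : H →* G) hp ⟨(ε : H →* K), fun x hx => h x hx⟩
  have hf : ∀ x, f (p x) = ε x := fun x =>
    MonoidHom.liftOfRightInverse_comp_apply (p : H →* G) _ _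
      ⟨(ε : H →* K), fun x hx => h x hx⟩ x
  exact ⟨⟨f, hq.continuous_iff.mpr (by simpa [Function.comp_def, hf] using ε.continuous_toFun)⟩, hf⟩

/-- A bijective continuous homomorphism from a compact group to a Hausdorff group is an
isomorphism. -/
noncomputable def continuousMulEquivOfBijective [T2Space G] (φ : H →ₜ* G)
    (hφ : Function.Bijective φ) : H ≃ₜ* G where
  toMulEquiv := MulEquiv.ofBijective φ hφ
  continuous_toFun := φ.continuous_toFun
  continuous_invFun := by
    have hq : IsQuotientMap φ :=
      IsQuotientMap.of_surjective_continuous hφ.2 φ.continuous_toFun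
    refine hq.continuous_iff.mpr ?_
    convert continuous_id
    funext x
    exact (MulEquiv.ofBijective φ hφ).symm_apply_apply x

/-- Factorizations of `φ` into epimorphisms correspond to closed normal subgroups inside the kernel,
through `H → H ⧸ N → G`. Every later use of indecomposability is this minimality. -/
theorem indecomposable_iff [T2Space G] (φ : H →ₜ* G) : Indecomposable φ ↔ Function.Surjective φ ∧
    ¬ Function.Injective φ ∧ ∀ N : Subgroup H, N.Normal → IsClosed (N : Set H) →
      N ≤ (φ : H →* G).ker → N = ⊥ ∨ N = (φ : H →* G).ker := by
  constructor
  · intro h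
    refine ⟨h.surjective, fun hi => h.not_bijective ⟨hi, h.surjective⟩, fun N _ hN hNφ => ?_⟩
    have := quotient_totallyDisconnectedSpace N hN
    let ψ : H →ₜ* H ⧸ N := ⟨QuotientGroup.mk' N, continuous_quot_mk⟩
    have hψ : Function.Surjective ψ := QuotientGroup.mk'_surjective N
    obtain ⟨ρ, hρ⟩ := exists_factor ψ hψ φ fun x hx => hNφ ((QuotientGroup.eq_one_iff x).mp hx)
    have hρs : Function.Surjective ρ := fun g => by
      obtain ⟨x, rfl⟩ := h.surjective g
      exact ⟨ψ x, hρ x⟩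
    rcases h.bijective_or_bijective _ ψ ρ hψ hρs (ContinuousMonoidHom.ext hρ) with hb | hb
    · left
      refine (Subgroup.eq_bot_iff_forall N).mpr fun x hx => ?_
      exact hb.1 (((QuotientGroup.eq_one_iff x).mpr hx).trans (map_one ψ).symm)
    · right
      refine le_antisymm hNφ fun x hx => (QuotientGroup.eq_one_iff x).mp ?_
      refine hb.1 (?_ : ρ (ψ x) = ρ 1)
      rw [hρ, map_one]
      exact hx
  · rintro ⟨hs, hi, hN⟩
    refine ⟨hs, fun hb => hi hb.1, fun E _ _ _ _ _ ψ ρ hψ hρ hc => ?_⟩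
    have hc' : ∀ x, ρ (ψ x) = φ x := fun x => DFunLike.congr_fun hc x
    have hcl : IsClosed ((ψ : H →* E).ker : Set H) :=
      isClosed_singleton.preimage ψ.continuous_toFun
    rcases hN (ψ : H →* E).ker inferInstance hcl (fun x (hx : ψ x = 1) => by
      change φ x = 1
      rw [← hc', hx, map_one]) with h | h
    · exact Or.inl ⟨(MonoidHom.ker_eq_bot_iff (ψ : H →* E)).mp h, hψ⟩
    · refine Or.inr ⟨(injective_iff_map_eq_one ρ).mpr fun e he => ?_, hρ⟩
      obtain ⟨x, rfl⟩ := hψ e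
      have : x ∈ (ψ : H →* E).ker := by
        rw [h]
        exact (hc' x).symm.trans he
      exact this

/-- An open normal subgroup that misses one nontrivial element of the kernel meets it trivially, by
minimality. The kernel then embeds in a finite quotient of `H`. -/
theorem Indecomposable.finite_ker [T2Space G] {φ : H →ₜ* G} (hφ : Indecomposable φ) :
    Finite (φ : H →* G).ker := by
  obtain ⟨-, hi, hN⟩ := (indecomposable_iff φ).mp hφ
  have : ∃ x, φ x = 1 ∧ x ≠ 1 := by
    by_contra! h
    exact hi ((injective_iff_map_eq_one φ).mpr h)
  obtain ⟨x, hx, hx1⟩ := this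
  obtain ⟨U, hU⟩ := exists_openNormalSubgroup_le (isOpen_compl_singleton.mem_nhds hx1.symm)
  have hxU : x ∉ (U : Subgroup H) := fun h => hU h rfl
  have hUc : IsClosed ((U : Subgroup H) : Set H) := (U : Subgroup H).isClosed_of_isOpen U.isOpen'
  have hKc : IsClosed ((φ : H →* G).ker : Set H) := isClosed_singleton.preimage φ.continuous_toFun
  have hbot : (U : Subgroup H) ⊓ (φ : H →* G).ker = ⊥ := by
    refine (hN _ inferInstance (hUc.inter hKc) inf_le_right).resolve_right fun h => hxU ?_
    have hxK : x ∈ (φ : H →* G).ker := hx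
    rw [← h] at hxK
    exact hxK.1
  have : Finite (H ⧸ (U : Subgroup H)) := Subgroup.quotient_finite_of_isOpen _ U.isOpen'
  refine Finite.of_injective (fun k : (φ : H →* G).ker => ((k : H) : H ⧸ (U : Subgroup H))) ?_
  intro k l hkl
  have h1 : (k : H)⁻¹ * l ∈ (U : Subgroup H) ⊓ (φ : H →* G).ker :=
    ⟨QuotientGroup.eq.mp hkl, Subgroup.mul_mem _ (Subgroup.inv_mem _ k.2) l.2⟩
  rw [hbot, Subgroup.mem_bot] at h1
  exact Subtype.ext (inv_mul_eq_one.mp h1)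

/-- An open normal subgroup meeting a finite kernel trivially. -/
theorem exists_openNormalSubgroup_disjoint (K : Subgroup H) [Finite K] :
    ∃ U : OpenNormalSubgroup H, ∀ x ∈ U, x ∈ K → x = 1 := by
  have hK : (K : Set H).Finite := Set.toFinite _
  have : ((K : Set H) \ {1})ᶜ ∈ 𝓝 (1 : H) :=
    (hK.subset Set.sdiff_subset).isClosed.isOpen_compl.mem_nhds (by simp)
  obtain ⟨U, hU⟩ := exists_openNormalSubgroup_le this
  refine ⟨U, fun x hx hxK => ?_⟩
  by_contra h
  exact hU hx ⟨hxK, h⟩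

end Profinite

/-! ### Fiber products and the embedded kernels of their factors -/

section FiberProduct

variable {I G : Type*} {H : I → Type*} [Group G] [TopologicalSpace G]
  [∀ i, Group (H i)] [∀ i, TopologicalSpace (H i)] {η : ∀ i, H i →ₜ* G}

theorem isClosed_fiberProd [T2Space G] :
    IsClosed (fiberProd η : Set (G × ∀ i, H i)) := by
  have : (fiberProd η : Set (G × ∀ i, H i)) = ⋂ i, {x | η i (x.2 i) = x.1} := by
    ext x
    simp [fiberProd]
  rw [this]
  exact isClosed_iInter fun i => isClosed_eq
    ((η i).continuous_toFun.comp (by fun_prop)) continuous_fst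

theorem compactSpace_fiberProd [T2Space G] [CompactSpace G] [∀ i, CompactSpace (H i)] :
    CompactSpace (fiberProd η) :=
  isCompact_iff_compactSpace.mp isClosed_fiberProd.isCompact

theorem fiberProdMap_surjective (hη : ∀ i, Function.Surjective (η i)) :
    Function.Surjective (fiberProdMap η) := fun g => by
  choose h hh using fun i => hη i g
  exact ⟨⟨(g, h), hh⟩, rfl⟩

theorem map_fiberProdProj (i : I) (x : fiberProd η) :
    η i (fiberProdProj η i x) = fiberProdMap η x := x.2 i

open Classical in
theorem fiberProdProj_surjective (hη : ∀ i, Function.Surjective (η i)) (i : I) :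
    Function.Surjective (fiberProdProj η i) := fun k => by
  choose h hh using fun j => hη j (η i k)
  refine ⟨⟨(η i k, Function.update h i k), fun j => ?_⟩, ?_⟩
  · by_cases hj : j = i
    · subst hj
      simp
    · simp [hj, hh]
  · change Function.update h i k i = k
    simp

open Classical in
theorem fiberProdRestrict_surjective (hη : ∀ i, Function.Surjective (η i)) (J : Set I) :
    Function.Surjective (fiberProdRestrict η J) := fun k => by
  choose h hh using fun j => hη j k.1.1
  refine ⟨⟨(k.1.1, fun i => if hi : i ∈ J then k.1.2 ⟨i, hi⟩ else h i), fun j => ?_⟩, ?_⟩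
  · by_cases hj : j ∈ J
    · simpa [hj] using k.2 ⟨j, hj⟩
    · simp [hj, hh]
  · refine Subtype.ext (Prod.ext rfl (funext fun j => ?_))
    change (if hi : (j : I) ∈ J then k.1.2 ⟨j, hi⟩ else h j) = k.1.2 j
    simp

open Classical in
/-- The inclusion of the kernel of `η i` into the fiber product. -/
noncomputable def fiberProdSingle (η : ∀ i, H i →ₜ* G) (i : I) :
    (η i : H i →* G).ker →* fiberProd η where
  toFun k := ⟨(1, Pi.mulSingle i (k : H i)), fun j => by
    by_cases hj : j = i
    · subst hj
      simpa using (show η j k = 1 from k.2)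
    · simp [hj]⟩
  map_one' := by
    ext <;> simp
  map_mul' k l := by
    ext j <;> simp [Pi.mulSingle_mul]

@[simp]
theorem fiberProdMap_single (i : I) (k : (η i : H i →* G).ker) :
    fiberProdMap η (fiberProdSingle η i k) = 1 := rfl

@[simp]
theorem fiberProdProj_single_same (i : I) (k : (η i : H i →* G).ker) :
    fiberProdProj η i (fiberProdSingle η i k) = k := by
  classical
  exact Pi.mulSingle_eq_same i (k : H i)

theorem fiberProdProj_single_ne {i j : I} (h : j ≠ i) (k : (η i : H i →* G).ker) :
    fiberProdProj η j (fiberProdSingle η i k) = 1 := by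
  classical
  exact Pi.mulSingle_eq_of_ne h (k : H i)

theorem fiberProd_ext {x y : fiberProd η} (h : fiberProdMap η x = fiberProdMap η y)
    (h' : ∀ i, fiberProdProj η i x = fiberProdProj η i y) : x = y :=
  Subtype.ext (Prod.ext h (funext h'))

/-- Conjugation by `x` acts on the `i`-th kernel through the `i`-th coordinate alone. This transfers
normality and `G`-module structures between `H i` and the fiber product. -/
theorem conj_fiberProdSingle (x : fiberProd η) (i : I) (k : (η i : H i →* G).ker) :
    x * fiberProdSingle η i k * x⁻¹ =
      fiberProdSingle η i (MulAut.conjNormal (fiberProdProj η i x) k) := by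
  refine fiberProd_ext (by simp) fun j => ?_
  by_cases hj : j = i
  · subst hj
    simp
  · simp [fiberProdProj_single_ne hj]

theorem fiberProdSingle_commute {i j : I} (h : i ≠ j) (k : (η i : H i →* G).ker)
    (l : (η j : H j →* G).ker) : Commute (fiberProdSingle η i k) (fiberProdSingle η j l) := by
  refine fiberProd_ext (by simp) fun m => ?_
  by_cases hi : m = i
  · subst hi
    simp [fiberProdProj_single_ne h]
  · simp [fiberProdProj_single_ne hi]

theorem continuous_fiberProd {X : Type*} [TopologicalSpace X] {f : X → fiberProd η}
    (h : Continuous fun x => fiberProdMap η (f x))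
    (h' : ∀ i, Continuous fun x => fiberProdProj η i (f x)) : Continuous f :=
  Continuous.subtype_mk (h.prodMk (continuous_pi h')) _

theorem tendsto_fiberProd {X : Type*} {l : Filter X} {f : X → fiberProd η} {y : fiberProd η}
    (h : Tendsto (fun x => fiberProdMap η (f x)) l (𝓝 (fiberProdMap η y)))
    (h' : ∀ i, Tendsto (fun x => fiberProdProj η i (f x)) l (𝓝 (fiberProdProj η i y))) :
    Tendsto f l (𝓝 y) :=
  tendsto_subtype_rng.mpr (h.prodMk_nhds (tendsto_pi_nhds.mpr h'))

/-- A homomorphism to a profinite group with values in a finite subgroup on the kernels kills almost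
all kernels. -/
theorem finite_setOf_fiberProdSingle {E : Type*} [Group E] [TopologicalSpace E]
    [IsTopologicalGroup E] [CompactSpace E] [TotallyDisconnectedSpace E] (ε : fiberProd η →ₜ* E)
    (K : Subgroup E) [Finite K] (hK : ∀ i k, ε (fiberProdSingle η i k) ∈ K) :
    {i | ∃ k, ε (fiberProdSingle η i k) ≠ 1}.Finite := by
  classical
  obtain ⟨U, hU⟩ := exists_openNormalSubgroup_disjoint K
  -- A witness of nontriviality where there is one, and the value 1 elsewhere. Each coordinate of
  -- the embedded family is eventually 1, so the family tends to 1 along the cofinite filter.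
  let k : ∀ i, (η i : H i →* G).ker := fun i =>
    if h : ∃ k, ε (fiberProdSingle η i k) ≠ 1 then h.choose else 1
  have hk : Tendsto (fun i => fiberProdSingle η i (k i)) cofinite (𝓝 1) := by
    refine tendsto_fiberProd (by simpa using tendsto_const_nhds) fun j => ?_
    refine tendsto_const_nhds.congr' ?_
    have : ∀ᶠ i in cofinite, i ≠ j := by
      simp [Filter.eventually_cofinite]
    filter_upwards [this] with i hi
    rw [fiberProdProj_single_ne hi.symm, map_one]
  have h1 : Tendsto (fun i => ε (fiberProdSingle η i (k i))) cofinite (𝓝 (ε 1)) :=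
    (ε.continuous_toFun.tendsto 1).comp hk
  rw [map_one] at h1
  have h2 := h1.eventually (U.isOpen'.mem_nhds (one_mem (U : Subgroup E)))
  refine (Filter.eventually_cofinite.mp h2).subset fun i hi hi' => ?_
  -- For almost all `i` the image lies in `U` and in `K`, whose intersection is trivial.
  have h3 := hU _ hi' (hK i (k i))
  rw [show k i = hi.choose from dif_pos hi] at h3
  exact hi.choose_spec h3

/-- The product of the kernels is topologically generated by the kernels. -/
theorem eq_one_of_forall_fiberProdSingle {E : Type*} [Group E] [TopologicalSpace E] [T2Space E]
    (ε : fiberProd η →ₜ* E) (T : Set I) (hT : ∀ i ∈ T, ∀ k, ε (fiberProdSingle η i k) = 1)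
    (x : fiberProd η) (hx : fiberProdMap η x = 1) (hxT : ∀ i ∉ T, fiberProdProj η i x = 1) :
    ε x = 1 := by
  classical
  have hker : ∀ i, fiberProdProj η i x ∈ (η i : H i →* G).ker := fun i =>
    (map_fiberProdProj i x).trans hx
  have h0 : ∀ i, ε (fiberProdSingle η i ⟨_, hker i⟩) = 1 := fun i => by
    by_cases hi : i ∈ T
    · exact hT i hi _
    · have : (⟨fiberProdProj η i x, hker i⟩ : (η i : H i →* G).ker) = 1 := Subtype.ext (hxT i hi)
      rw [this, map_one, map_one]
  -- Truncations of `x` to finitely many coordinates are finite products of kernel elements killed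
  -- by `ε`. They converge to `x` along the finite subsets of `I`.
  have key : ∀ F : Finset I, ∃ y : fiberProd η, ε y = 1 ∧ fiberProdMap η y = 1 ∧
      ∀ i, fiberProdProj η i y = if i ∈ F then fiberProdProj η i x else 1 := by
    intro F
    induction F using Finset.induction_on with
    | empty => exact ⟨1, by simp⟩
    | insert a F ha ih =>
      obtain ⟨y, hy1, hy2, hy3⟩ := ih
      refine ⟨fiberProdSingle η a ⟨_, hker a⟩ * y, by simp [h0, hy1], by simp [hy2], fun i => ?_⟩
      rw [map_mul, hy3]
      by_cases hi : i = a
      · subst hi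
        simp [ha]
      · simp [fiberProdProj_single_ne hi, hi]
  choose y hy1 hy2 hy3 using key
  have hy : Tendsto y atTop (𝓝 x) := by
    refine tendsto_fiberProd (by simpa [hy2, hx] using tendsto_const_nhds) fun j => ?_
    refine tendsto_const_nhds.congr' ?_
    filter_upwards [Filter.eventually_ge_atTop ({j} : Finset I)] with F hF
    rw [hy3, if_pos (hF (Finset.mem_singleton_self j))]
  have h1 : Tendsto (fun F => ε (y F)) atTop (𝓝 (ε x)) := (ε.continuous_toFun.tendsto x).comp hy
  simp only [hy1] at h1
  exact (tendsto_nhds_unique h1 tendsto_const_nhds)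

end FiberProduct

/-! ### Epimorphisms from the fiber product onto an indecomposable cover -/

section Dominated

variable {I G : Type*} [Group G] [TopologicalSpace G] [IsTopologicalGroup G] [CompactSpace G]
  [TotallyDisconnectedSpace G] {H : I → Type*} [∀ i, Group (H i)] [∀ i, TopologicalSpace (H i)]
  [∀ i, IsTopologicalGroup (H i)] [∀ i, CompactSpace (H i)] [∀ i, TotallyDisconnectedSpace (H i)]
  {η : ∀ i, H i →ₜ* G}
  {E : Type*} [Group E] [TopologicalSpace E] [IsTopologicalGroup E] [CompactSpace E]
  [TotallyDisconnectedSpace E]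

/-- For `i ≠ j` the `j`-th kernel, which is nontrivial, is killed by the projection to `H i` but
embedded by the projection to `H j`. This gives the uniqueness of the index in the non-abelian case.
-/
theorem fiberProdProj_ker_injective (hη : ∀ i, Indecomposable (η i)) {i j : I}
    (h : (fiberProdProj η i : fiberProd η →* H i).ker ≤
      (fiberProdProj η j : fiberProd η →* H j).ker) : i = j := by
  by_contra hij
  refine ((indecomposable_iff (η j)).mp (hη j)).2.1
    ((injective_iff_map_eq_one _).mpr fun k hk => ?_)
  have h1 : fiberProdProj η j (fiberProdSingle η j ⟨k, hk⟩) = 1 :=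
    h (fiberProdProj_single_ne hij _)
  simpa using h1

/-- A homomorphism on the fiber product is trivial or injective on each of the kernels. -/
theorem fiberProdSingle_trivial_or_injective (hη : ∀ i, Indecomposable (η i))
    (ε : fiberProd η →ₜ* E) (i : I) :
    (∀ k, ε (fiberProdSingle η i k) = 1) ∨ ∀ k, ε (fiberProdSingle η i k) = 1 → k = 1 := by
  have := (hη i).finite_ker
  -- The part of the `i`-th kernel killed by `ε`. Every element of `H i` lifts to the fiber product,
  -- so this subgroup is normal in `H i` and minimality applies.
  let N : Subgroup (H i) :=
    ((ε : fiberProd η →* E).comp (fiberProdSingle η i)).ker.map (η i : H i →* G).ker.subtype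
  have hle : N ≤ (η i : H i →* G).ker := by
    rintro _ ⟨k, -, rfl⟩
    exact k.2
  have hn : N.Normal := by
    refine ⟨?_⟩
    rintro _ ⟨k, hk, rfl⟩ h
    obtain ⟨x, rfl⟩ := fiberProdProj_surjective (fun i => (hη i).surjective) i h
    refine ⟨MulAut.conjNormal (fiberProdProj η i x) k, ?_, by simp⟩
    have hk' : ε (fiberProdSingle η i k) = 1 := hk
    change ε (fiberProdSingle η i _) = 1
    rw [← conj_fiberProdSingle]
    simp [hk']
  have hf : (N : Set (H i)).Finite := (Set.toFinite ((η i : H i →* G).ker : Set (H i))).subset hle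
  rcases ((indecomposable_iff (η i)).mp (hη i)).2.2 N hn hf.isClosed hle with h | h
  · right
    intro k hk
    have : (k : H i) ∈ N := ⟨k, hk, rfl⟩
    rw [h, Subgroup.mem_bot] at this
    exact Subtype.ext this
  · left
    intro k
    have : (k : H i) ∈ N := h.symm ▸ k.2
    obtain ⟨l, hl, hlk⟩ := this
    rw [← Subtype.ext hlk]
    exact hl

variable {ζ : E →ₜ* G} {ε : fiberProd η →ₜ* E}

/-- Minimality of `Ker (η i)` gives injectivity. Since `ε` is surjective, the image of this kernel
is normal in `E`, and minimality of the kernel of `ζ` gives the rest. -/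
theorem fiberProdSingle_trivial_or_range (hη : ∀ i, Indecomposable (η i)) (hζ : Indecomposable ζ)
    (hε : Function.Surjective ε) (hc : ∀ x, ζ (ε x) = fiberProdMap η x) (i : I) :
    (∀ k, ε (fiberProdSingle η i k) = 1) ∨
      ((∀ k, ε (fiberProdSingle η i k) = 1 → k = 1) ∧
        ∀ c ∈ (ζ : E →* G).ker, ∃ k, ε (fiberProdSingle η i k) = c) := by
  have := hζ.finite_ker
  rcases fiberProdSingle_trivial_or_injective hη ε i with ht | hi
  · exact Or.inl ht
  let N : Subgroup E := ((ε : fiberProd η →* E).comp (fiberProdSingle η i)).range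
  have hle : N ≤ (ζ : E →* G).ker := by
    rintro _ ⟨k, rfl⟩
    exact hc _
  have hn : N.Normal := by
    refine ⟨?_⟩
    rintro _ ⟨k, rfl⟩ e
    obtain ⟨x, rfl⟩ := hε e
    refine ⟨MulAut.conjNormal (fiberProdProj η i x) k, ?_⟩
    change ε (fiberProdSingle η i _) = ε x * ε (fiberProdSingle η i k) * (ε x)⁻¹
    rw [← conj_fiberProdSingle]
    simp
  have hf : (N : Set E).Finite := (Set.toFinite ((ζ : E →* G).ker : Set E)).subset hle
  rcases ((indecomposable_iff ζ).mp hζ).2.2 N hn hf.isClosed hle with h | h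
  · left
    intro k
    have : ε (fiberProdSingle η i k) ∈ N := ⟨k, rfl⟩
    rwa [h] at this
  · exact Or.inr ⟨hi, fun c hcζ => (h.ge hcζ : c ∈ N)⟩

/-- A dominated cover sees one of the kernels. -/
theorem exists_fiberProdSingle_ne_one (hζ : Indecomposable ζ)
    (hε : Function.Surjective ε) (hc : ∀ x, ζ (ε x) = fiberProdMap η x) :
    ∃ i k, ε (fiberProdSingle η i k) ≠ 1 := by
  by_contra! h
  refine ((indecomposable_iff ζ).mp hζ).2.1 ((injective_iff_map_eq_one _).mpr fun e he => ?_)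
  obtain ⟨x, rfl⟩ := hε e
  rw [hc] at he
  exact eq_one_of_forall_fiberProdSingle ε Set.univ (fun i _ => h i) x he (by simp)

/-- A cover of `G` with non-abelian kernel which is dominated by the fiber product is isomorphic to
one of the factors. -/
theorem exists_factor_of_not_isMulCommutative (hη : ∀ i, Indecomposable (η i))
    (hζ : Indecomposable ζ) (hε : Function.Surjective ε) (hc : ∀ x, ζ (ε x) = fiberProdMap η x)
    (hC : ¬ IsMulCommutative (ζ : E →* G).ker) :
    ∃ (j : I) (εj : H j ≃ₜ* E), (∀ x, εj (fiberProdProj η j x) = ε x) ∧ ∀ h, ζ (εj h) = η j h := by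
  have := compactSpace_fiberProd (η := η)
  obtain ⟨j, k, hk⟩ := exists_fiberProdSingle_ne_one hζ hε hc
  have hj := (fiberProdSingle_trivial_or_range hη hζ hε hc j).resolve_left fun h => hk (h k)
  -- A second surviving factor would also map onto the kernel of `ζ`. As it commutes with the `j`-th
  -- factor, that kernel would be abelian.
  have hi : ∀ i ≠ j, ∀ l, ε (fiberProdSingle η i l) = 1 := by
    intro i hij
    refine (fiberProdSingle_trivial_or_range hη hζ hε hc i).resolve_right fun hi => hC ?_
    refine isMulCommutative_iff.mpr fun a b => Subtype.ext ?_
    obtain ⟨l, hl⟩ := hi.2 a a.2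
    obtain ⟨m, hm⟩ := hj.2 b b.2
    change (a : E) * b = b * a
    rw [← hl, ← hm, ← map_mul, (fiberProdSingle_commute hij l m).eq, map_mul]
  obtain ⟨εj, hεj⟩ := exists_factor (fiberProdProj η j)
    (fiberProdProj_surjective (fun i => (hη i).surjective) j) ε fun x hx =>
      eq_one_of_forall_fiberProdSingle ε {i | i ≠ j} hi x
        (by rw [← map_fiberProdProj j x, hx, map_one])
        (fun i hi => by
          obtain rfl : i = j := not_not.mp hi
          exact hx)
  have hζj : ∀ h, ζ (εj h) = η j h := fun h => by
    obtain ⟨x, rfl⟩ := fiberProdProj_surjective (fun i => (hη i).surjective) j h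
    rw [hεj, hc, map_fiberProdProj]
  have hs : Function.Surjective εj := fun e => by
    obtain ⟨x, rfl⟩ := hε e
    exact ⟨_, hεj x⟩
  have hinj : Function.Injective εj := by
    refine (injective_iff_map_eq_one _).mpr fun h hh => ?_
    have h1 : η j h = 1 := by rw [← hζj, hh, map_one]
    have h2 := hj.1 ⟨h, h1⟩ (by rw [← hεj, fiberProdProj_single_same]; exact hh)
    exact congrArg Subtype.val h2
  exact ⟨j, continuousMulEquivOfBijective εj ⟨hinj, hs⟩, hεj, hζj⟩

/-- A factor of the fiber product is dominated by it. -/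
theorem exists_dominated_of_coverIso (hη : ∀ i, Function.Surjective (η i)) {i : I}
    (h : CoverIso (η i) ζ) :
    ∃ ε : fiberProd η →ₜ* E, Function.Surjective ε ∧ ∀ x, ζ (ε x) = fiberProdMap η x := by
  obtain ⟨e, he⟩ := h
  refine ⟨(⟨e, e.continuous_toFun⟩ : H i →ₜ* E).comp (fiberProdProj η i),
    e.surjective.comp (fiberProdProj_surjective hη i), fun x => ?_⟩
  exact (he _).trans (map_fiberProdProj i x)

variable {A : Type*} [AddCommGroup A] {ρ : Representation ℤ G A}

/-- If a dominated cover is nontrivial on the `i`-th kernel, then this kernel is isomorphic to the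
kernel of the cover. -/
theorem mem_kerIndex_of_ne_one (hη : ∀ i, Indecomposable (η i)) (hζ : Indecomposable ζ)
    (hε : Function.Surjective ε) (hc : ∀ x, ζ (ε x) = fiberProdMap η x)
    (θ : KerEquiv (ζ : E →* G) ρ) {i : I} {k : (η i : H i →* G).ker}
    (hk : ε (fiberProdSingle η i k) ≠ 1) : i ∈ kerIndex η ρ := by
  have hi := (fiberProdSingle_trivial_or_range hη hζ hε hc i).resolve_left fun h => hk (h k)
  -- The restriction of `ε` is the required isomorphism of modules; equivariance holds because `ε`
  -- respects conjugation and the maps to `G`.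
  let f : (η i : H i →* G).ker →* (ζ : E →* G).ker :=
    ((ε : fiberProd η →* E).comp (fiberProdSingle η i)).codRestrict _ fun k => hc _
  have hf : Function.Bijective f :=
    ⟨(injective_iff_map_eq_one f).mpr fun k hk => hi.1 k (congrArg Subtype.val hk), fun c => by
      obtain ⟨k, hk⟩ := hi.2 c c.2
      exact ⟨k, Subtype.ext hk⟩⟩
  refine ⟨⟨(MulEquiv.toAdditive (MulEquiv.ofBijective f hf)).trans θ.toAddEquiv, fun h k => ?_⟩⟩
  obtain ⟨x, rfl⟩ := fiberProdProj_surjective (fun i => (hη i).surjective) i h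
  have h1 : f (MulAut.conjNormal (fiberProdProj η i x) k) = MulAut.conjNormal (ε x) (f k) := by
    refine Subtype.ext ?_
    change ε (fiberProdSingle η i _) = _
    rw [← conj_fiberProdSingle, map_mul, map_mul, map_inv]
    rfl
  have h2 := θ.map_conj (ε x) (f k)
  rw [← h1] at h2
  refine h2.trans ?_
  change ρ (ζ (ε x)) _ = ρ (η i (fiberProdProj η i x)) _
  rw [hc, map_fiberProdProj]
  rfl

/-- A dominated cover with abelian kernel `A` is dominated by the fiber product of the covers with
kernel `A`. -/
theorem exists_factor_kerIndex (hη : ∀ i, Indecomposable (η i)) (hζ : Indecomposable ζ)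
    (hε : Function.Surjective ε) (hc : ∀ x, ζ (ε x) = fiberProdMap η x)
    (θ : KerEquiv (ζ : E →* G) ρ) :
    ∃ ε' : fiberProd (fun i : kerIndex η ρ => η i) →ₜ* E, Function.Surjective ε' ∧
      (∀ h, ε' (fiberProdRestrict η (kerIndex η ρ) h) = ε h) ∧
      ∀ h, ζ (ε' h) = fiberProdMap (fun i : kerIndex η ρ => η i) h := by
  have := compactSpace_fiberProd (η := η)
  have hs := fiberProdRestrict_surjective (fun i => (hη i).surjective) (kerIndex η ρ)
  obtain ⟨ε', hε'⟩ := exists_factor (fiberProdRestrict η (kerIndex η ρ)) hs ε fun x hx =>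
      eq_one_of_forall_fiberProdSingle ε (kerIndex η ρ)ᶜ
        (fun i hi k => by
          by_contra hk
          exact hi (mem_kerIndex_of_ne_one hη hζ hε hc θ hk)) x
        (congrArg (fun y => y.1.1) hx)
        (fun i hi => congrArg (fun y => y.1.2 ⟨i, not_not.mp hi⟩) hx)
  refine ⟨ε', fun e => ?_, hε', fun h => ?_⟩
  · obtain ⟨x, rfl⟩ := hε e
    exact ⟨_, hε' x⟩
  · obtain ⟨x, rfl⟩ := hs h
    rw [hε', hc]
    rfl

end Dominated

/-! ### Continuous sections -/

section Section

variable {H G : Type*} [Group H] [TopologicalSpace H] [IsTopologicalGroup H] [CompactSpace H]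
  [TotallyDisconnectedSpace H] [Group G] [TopologicalSpace G] [IsTopologicalGroup G] [T2Space G]

/-- An epimorphism of profinite groups with finite kernel has a continuous section. -/
theorem exists_continuous_section (φ : H →ₜ* G) (hφ : Function.Surjective φ)
    [Finite (φ : H →* G).ker] : ∃ s : C(G, H), ∀ g, φ (s g) = g := by
  obtain ⟨U, hU⟩ := exists_openNormalSubgroup_disjoint (φ : H →* G).ker
  have hUc : IsClosed ((U : Subgroup H) : Set H) := (U : Subgroup H).isClosed_of_isOpen U.isOpen'
  have hq : IsOpenMap φ := (MonoidHom.isOpenQuotientMap_of_isQuotientMap (φ := (φ : H →* G))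
    (IsQuotientMap.of_surjective_continuous hφ φ.continuous_toFun)).isOpenMap
  let V : Subgroup G := (U : Subgroup H).map (φ : H →* G)
  -- As `φ` is open, `V` is open; hence an arbitrary choice of representatives on `G ⧸ V` is
  -- continuous.
  have hV : DiscreteTopology (G ⧸ V) := QuotientGroup.discreteTopology (hq _ U.isOpen')
  let r : G ⧸ V → H := fun c => Function.surjInv hφ c.out
  have hr : ∀ c, (φ (r c) : G ⧸ V) = c := fun c => by
    simp only [r, Function.surjInv_eq hφ]
    exact Quotient.out_eq' c
  have hrc : Continuous fun h : H => (r (φ h : G ⧸ V))⁻¹ * h :=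
    ((continuous_of_discreteTopology (f := r)).comp
      (continuous_quot_mk.comp φ.continuous_toFun)).inv.mul continuous_id
  -- The elements congruent modulo `U` to the chosen representative of their coset. Two of them over
  -- the same point differ by an element of `U` in the kernel, so `S` is a closed, hence compact,
  -- set of representatives and the inverse of `S → G` is continuous.
  let S : Set H := {h | (r (φ h : G ⧸ V))⁻¹ * h ∈ (U : Subgroup H)}
  have hS : IsClosed S := hUc.preimage hrc
  have : CompactSpace S := isCompact_iff_compactSpace.mp hS.isCompact
  have hb : Function.Bijective fun h : S => φ h := by
    constructor
    · rintro ⟨h, hh⟩ ⟨k, hk⟩ (hhk : φ h = φ k)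
      simp only [S, Set.mem_ofPred_eq] at hh hk
      rw [hhk] at hh
      have h1 := mul_mem (inv_mem hh) hk
      refine Subtype.ext (inv_mul_eq_one.mp (hU (h⁻¹ * k) ?_ ?_))
      · have h2 : h⁻¹ * k = ((r (φ k : G ⧸ V))⁻¹ * h)⁻¹ * ((r (φ k : G ⧸ V))⁻¹ * k) := by group
        rw [h2]
        exact h1
      · simp [MonoidHom.mem_ker, hhk]
    · intro g
      obtain ⟨u, hu, hug⟩ := QuotientGroup.eq.mp (hr (g : G ⧸ V))
      have hug' : φ u = (φ (r (g : G ⧸ V)))⁻¹ * g := hug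
      have h1 : φ (r (g : G ⧸ V) * u) = g := by rw [map_mul, hug', mul_inv_cancel_left]
      exact ⟨⟨r (g : G ⧸ V) * u, by simpa [S, h1] using hu⟩, h1⟩
  let e : S ≃ G := Equiv.ofBijective _ hb
  have he : Continuous e := φ.continuous_toFun.comp continuous_subtype_val
  let e' : S ≃ₜ G := he.homeoOfEquivCompactToT2
  exact ⟨⟨fun g => (e'.symm g : H), continuous_subtype_val.comp e'.symm.continuous⟩,
    fun g => e'.apply_symm_apply g⟩

end Section

/-! ### Kernels as modules -/

namespace KerEquiv

variable {H G : Type*} [Group H] [Group G] {φ : H →* G} {A : Type*} [AddCommGroup A]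
  {ρ : Representation ℤ G A} (θ : KerEquiv φ ρ)

/-- The inclusion of the module `A ≅ Ker φ` in `H`. -/
def incl (a : A) : H := ((θ.toAddEquiv.symm a).toMul : φ.ker)

theorem apply_ofMul (x : φ.ker) {a : A} : θ.toAddEquiv (Additive.ofMul x) = a ↔ x = θ.incl a := by
  rw [← AddEquiv.eq_symm_apply]
  exact ⟨fun h => congrArg (fun y => ((Additive.toMul y : φ.ker) : H)) h, fun h => Subtype.ext h⟩

@[simp]
theorem map_incl (a : A) : φ (θ.incl a) = 1 := (θ.toAddEquiv.symm a).toMul.2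

theorem incl_apply (x : φ.ker) : θ.incl (θ.toAddEquiv (Additive.ofMul x)) = x :=
  ((θ.apply_ofMul x).mp rfl).symm

theorem exists_incl (x : H) (hx : φ x = 1) : ∃ a, θ.incl a = x :=
  ⟨_, θ.incl_apply ⟨x, hx⟩⟩

theorem incl_add (a b : A) : θ.incl (a + b) = θ.incl a * θ.incl b := by
  simp [incl]

@[simp]
theorem incl_zero : θ.incl 0 = 1 := by
  simp [incl]

theorem incl_injective : Function.Injective θ.incl := fun _ _ h =>
  θ.toAddEquiv.symm.injective (Subtype.ext h)

theorem incl_eq_one {a : A} (h : θ.incl a = 1) : a = 0 := θ.incl_injective (h.trans θ.incl_zero.symm)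

theorem mul_incl (h : H) (a : A) : h * θ.incl a = θ.incl (ρ (φ h) a) * h := by
  have h1 := θ.map_conj h (θ.toAddEquiv.symm a).toMul
  have h2 := (θ.apply_ofMul _).mp h1
  rw [MulAut.conjNormal_apply] at h2
  have h3 : θ.toFun (Additive.ofMul (θ.toAddEquiv.symm a).toMul) = a :=
    θ.toAddEquiv.apply_symm_apply a
  rw [h3] at h2
  rw [← h2]
  simp [incl]

end KerEquiv

/-! ### Cocycles and extension classes -/

section ExtensionClass

variable {H G : Type*} [Group H] [TopologicalSpace H] [IsTopologicalGroup H] [CompactSpace H]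
  [TotallyDisconnectedSpace H] [Group G] [TopologicalSpace G] [IsTopologicalGroup G]
  [T2Space G] {A : Type*} [AddCommGroup A] {ρ : Representation ℤ G A} {φ : H →ₜ* G}
  (θ : KerEquiv (φ : H →* G) ρ)

/-- Continuous maps to a finite kernel are locally constant. -/
theorem exists_locallyConstant [Finite (φ : H →* G).ker] {X : Type*} [TopologicalSpace X]
    (u : X → H) (hu : Continuous u) (h : ∀ x, φ (u x) = 1) :
    ∃ y : LocallyConstant X A, ∀ x, u x = θ.incl (y x) := by
  have hl : IsLocallyConstant fun x => (⟨u x, h x⟩ : (φ : H →* G).ker) :=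
    (IsLocallyConstant.iff_continuous _).mpr (hu.subtype_mk _)
  exact ⟨⟨fun x => θ.toAddEquiv (Additive.ofMul ⟨u x, h x⟩), hl.comp _⟩,
    fun x => (θ.incl_apply ⟨u x, h x⟩).symm⟩

theorem section_mul_incl {s : G → H} (hs : ∀ σ, φ (s σ) = σ) (σ : G) (a : A) :
    s σ * θ.incl a = θ.incl (ρ σ a) * s σ := by
  have h := θ.mul_incl (s σ) a
  rwa [show (φ : H →* G) (s σ) = σ from hs σ] at h

/-- The cocycle of a continuous section. -/
theorem exists_cocycle [Finite (φ : H →* G).ker] (s : C(G, H)) (hs : ∀ σ, φ (s σ) = σ) :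
    ∃ f : Z2 ρ, ∀ σ τ, s σ * s τ = θ.incl (f.1 (σ, τ)) * s (σ * τ) := by
  obtain ⟨f, hf⟩ := exists_locallyConstant θ
    (fun p : G × G => s p.1 * s p.2 * (s (p.1 * p.2))⁻¹) (by fun_prop) (by simp [hs])
  have hf' : ∀ σ τ, s σ * s τ = θ.incl (f (σ, τ)) * s (σ * τ) := fun σ τ => by
    rw [← hf]
    group
  refine ⟨⟨f, fun σ τ υ => θ.incl_injective ?_⟩, hf'⟩
  -- After this multiplication, both sides of the cocycle identity compute `s σ * s τ * s υ`, with
  -- the two possible bracketings.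
  rw [← mul_left_inj (s (σ * τ * υ))]
  calc θ.incl (ρ σ (f (τ, υ)) + f (σ, τ * υ)) * s (σ * τ * υ)
      = θ.incl (ρ σ (f (τ, υ))) * s σ * s (τ * υ) := by
        rw [θ.incl_add, mul_assoc σ, mul_assoc, ← hf', mul_assoc]
    _ = s σ * s τ * s υ := by
        rw [← section_mul_incl θ hs, mul_assoc, ← hf', mul_assoc]
    _ = θ.incl (f (σ * τ, υ) + f (σ, τ)) * s (σ * τ * υ) := by
        rw [hf', add_comm, θ.incl_add, mul_assoc, hf', mul_assoc, mul_assoc]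

theorem isExtensionClass_iff {x : H2 ρ} : IsExtensionClass φ θ x ↔
    ∃ s : C(G, H), (∀ σ, φ (s σ) = σ) ∧ ∃ f : Z2 ρ,
      (∀ σ τ, s σ * s τ = θ.incl (f.1 (σ, τ)) * s (σ * τ)) ∧ Submodule.Quotient.mk f = x := by
  refine ⟨fun ⟨s, hs, f, hf, hx⟩ => ⟨s, hs, f, fun σ τ => ?_, hx⟩,
    fun ⟨s, hs, f, hf, hx⟩ => ⟨s, hs, f, fun σ τ => ?_, hx⟩⟩
  · have h := (θ.apply_ofMul _).mp (hf σ τ).symm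
    exact mul_inv_eq_iff_eq_mul.mp h
  · exact ((θ.apply_ofMul _).mpr (mul_inv_eq_iff_eq_mul.mpr (hf σ τ))).symm

theorem exists_isExtensionClass [Finite (φ : H →* G).ker] (hφ : Function.Surjective φ) :
    ∃ x, IsExtensionClass φ θ x := by
  obtain ⟨s, hs⟩ := exists_continuous_section φ hφ
  obtain ⟨f, hf⟩ := exists_cocycle θ s hs
  exact ⟨_, (isExtensionClass_iff θ).mpr ⟨s, hs, f, hf, rfl⟩⟩

/-- The effect of a change of the section on the cocycle. -/
theorem cocycle_change {s s' : G → H} (hs : ∀ σ, φ (s σ) = σ) {y : G → A}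
    (hy : ∀ σ, s' σ = θ.incl (y σ) * s σ) {f : G × G → A}
    (hf : ∀ σ τ, s σ * s τ = θ.incl (f (σ, τ)) * s (σ * τ)) (σ τ : G) :
    s' σ * s' τ =
      θ.incl (f (σ, τ) + (ρ σ (y τ) - y (σ * τ) + y σ)) * s' (σ * τ) := by
  have h1 : s σ * θ.incl (y τ) = θ.incl (ρ σ (y τ)) * s σ :=
    section_mul_incl θ hs σ (y τ)
  calc s' σ * s' τ = θ.incl (y σ) * (s σ * θ.incl (y τ)) * s τ := by rw [hy, hy]; group
    _ = θ.incl (y σ) * θ.incl (ρ σ (y τ)) * (s σ * s τ) := by rw [h1]; group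
    _ = θ.incl (y σ) * θ.incl (ρ σ (y τ)) * θ.incl (f (σ, τ)) * s (σ * τ) := by rw [hf]; group
    _ = θ.incl (f (σ, τ) + (ρ σ (y τ) - y (σ * τ) + y σ)) * (θ.incl (y (σ * τ)) * s (σ * τ)) := by
      rw [← mul_assoc]
      simp only [← θ.incl_add]
      congr 2
      abel
    _ = _ := by rw [← hy]

/-- Two continuous sections differ by a locally constant cochain, as the kernel is finite; its
coboundary is the difference of the cocycles. -/
theorem IsExtensionClass.unique [Finite (φ : H →* G).ker] {x x' : H2 ρ}
    (hx : IsExtensionClass φ θ x) (hx' : IsExtensionClass φ θ x') : x = x' := by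
  obtain ⟨s, hs, f, hf, rfl⟩ := (isExtensionClass_iff θ).mp hx
  obtain ⟨s', hs', f', hf', rfl⟩ := (isExtensionClass_iff θ).mp hx'
  obtain ⟨y, hy⟩ := exists_locallyConstant θ (fun σ => s σ * (s' σ)⁻¹) (by fun_prop)
    (by simp [hs, hs'])
  refine (Submodule.Quotient.eq _).mpr ⟨y, fun σ τ => ?_⟩
  have h := cocycle_change θ hs' (s' := s) (y := y) (fun σ => by rw [← hy]; group) hf' σ τ
  rw [hf, mul_left_inj] at h
  exact sub_eq_iff_eq_add'.mpr (θ.incl_injective h)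

end ExtensionClass

/-! ### Dominated covers with abelian kernel and linear combinations of classes -/

section Combination

variable {I G : Type*} [Group G] [TopologicalSpace G] [IsTopologicalGroup G] [CompactSpace G]
  [TotallyDisconnectedSpace G] {H : I → Type*} [∀ i, Group (H i)] [∀ i, TopologicalSpace (H i)]
  [∀ i, IsTopologicalGroup (H i)] [∀ i, CompactSpace (H i)] [∀ i, TotallyDisconnectedSpace (H i)]
  {η : ∀ i, H i →ₜ* G}
  {E : Type*} [Group E] [TopologicalSpace E] [IsTopologicalGroup E] [CompactSpace E]
  [TotallyDisconnectedSpace E] {ζ : E →ₜ* G} {ε : fiberProd η →ₜ* E}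
  {A : Type*} [AddCommGroup A] {ρ : Representation ℤ G A}

theorem Z2.linearCombination_apply {ι : Type*} (f : ι → Z2 ρ) (a : ι →₀ endRing ρ) (p : G × G) :
    (Finsupp.linearCombination (endRing ρ) f a).1 p = ∑ i ∈ a.support, a i • (f i).1 p := by
  rw [Finsupp.linearCombination_apply, Finsupp.sum]
  exact map_sum ((LocallyConstant.evalAddMonoidHom p).comp (Z2 ρ).subtype.toAddMonoidHom) _ _

theorem H2.linearCombination_mk {ι : Type*} (f : ι → Z2 ρ) (a : ι →₀ endRing ρ) :
    Finsupp.linearCombination (endRing ρ) (fun i => (Submodule.Quotient.mk (f i) : H2 ρ)) a =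
      Submodule.Quotient.mk (Finsupp.linearCombination (endRing ρ) f a) := by
  exact (Finsupp.apply_linearCombination _ ((B2 ρ).submoduleOf (Z2 ρ)).mkQ f a).symm

/-- The restriction of a dominated cover to the `i`-th kernel, as a `G`-endomorphism of `A`. -/
theorem exists_coefficient (hη : ∀ i, Function.Surjective (η i))
    (hc : ∀ x, ζ (ε x) = fiberProdMap η x) (θ₀ : KerEquiv (ζ : E →* G) ρ) (i : I)
    (θ : KerEquiv (η i : H i →* G) ρ) :
    ∃ a : endRing ρ, ∀ k, ε (fiberProdSingle η i k) =
      θ₀.incl (a • θ.toAddEquiv (Additive.ofMul k)) := by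
  choose α hα using fun b : A => θ₀.exists_incl
    (ε (fiberProdSingle η i (θ.toAddEquiv.symm b).toMul)) (hc _)
  let f : A →+ A := AddMonoidHom.mk' α fun b c => θ₀.incl_injective (by
    rw [θ₀.incl_add, hα, hα, hα, map_add, toMul_add, map_mul, map_mul])
  refine ⟨⟨f.toIntLinearMap, Subring.mem_centralizer_iff.mpr ?_⟩, fun k => ?_⟩
  · rintro _ ⟨g, rfl⟩
    refine LinearMap.ext fun b => θ₀.incl_injective ?_
    change θ₀.incl (ρ g (α b)) = θ₀.incl (α (ρ g b))
    obtain ⟨x, rfl⟩ := fiberProdMap_surjective hη g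
    rw [← mul_left_inj (ε x), hα (ρ _ b)]
    have h1 := θ₀.mul_incl (ε x) (α b)
    have h2 : (ζ : E →* G) (ε x) = fiberProdMap η x := hc x
    rw [h2] at h1
    rw [← h1, hα, ← map_mul, ← map_mul]
    congr 1
    rw [← mul_inv_eq_iff_eq_mul, conj_fiberProdSingle]
    congr 1
    rw [← toMul_ofMul (MulAut.conjNormal _ _)]
    congr 1
    rw [AddEquiv.eq_symm_apply]
    have h3 := θ.map_conj (fiberProdProj η i x) (θ.toAddEquiv.symm b).toMul
    refine h3.trans ?_
    have h4 : (η i : H i →* G) (fiberProdProj η i x) = fiberProdMap η x := map_fiberProdProj i x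
    rw [h4]
    exact congrArg _ (θ.toAddEquiv.apply_symm_apply b)
  · refine Eq.trans ?_ (hα _).symm
    rw [AddEquiv.symm_apply_apply, toMul_ofMul]

/-- The class of a dominated cover is a nontrivial linear combination of classes of the factors. -/
theorem isNontrivialCombinationOfCovers_of_dominated (hη : ∀ i, Indecomposable (η i))
    (hζ : Indecomposable ζ) (hε : Function.Surjective ε) (hc : ∀ x, ζ (ε x) = fiberProdMap η x)
    (θ₀ : KerEquiv (ζ : E →* G) ρ)
    (θ : ∀ i : kerIndex η ρ, KerEquiv (η i : H i →* G) ρ) {z : H2 ρ}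
    (hz : IsExtensionClass ζ θ₀ z) :
    (kerIndex η ρ).Nonempty ∧ IsNontrivialCombinationOfCovers η θ z := by
  classical
  have := hζ.finite_ker
  have := fun i => (hη i).finite_ker
  have hηs := fun i => (hη i).surjective
  choose a ha using fun i : kerIndex η ρ => exists_coefficient hηs hc θ₀ i (θ i)
  -- A nonzero coefficient means that `ε` is nontrivial on the corresponding kernel, which happens
  -- only finitely often.
  have hfin : (Function.support a).Finite := by
    refine Set.Finite.of_finite_image
      ((finite_setOf_fiberProdSingle ε (ζ : E →* G).ker fun i k => hc _).subset ?_)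
      (f := Subtype.val) Subtype.val_injective.injOn
    rintro _ ⟨i, hi, rfl⟩
    by_contra! h
    refine hi (Subtype.ext (LinearMap.ext fun b => θ₀.incl_eq_one ?_))
    obtain ⟨k, rfl⟩ := (θ i).toAddEquiv.surjective b
    exact (ha i k.toMul).symm.trans (not_not.mp fun hk => h ⟨_, hk⟩)
  let a' : kerIndex η ρ →₀ endRing ρ := Finsupp.ofSupportFinite a hfin
  obtain ⟨i, k, hik⟩ := exists_fiberProdSingle_ne_one hζ hε hc
  have hi := mem_kerIndex_of_ne_one hη hζ hε hc θ₀ hik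
  have ha' : a' ≠ 0 := fun h => hik (by
    rw [ha ⟨i, hi⟩ k, show a ⟨i, hi⟩ = 0 from DFunLike.congr_fun h ⟨i, hi⟩]
    simp)
  choose s hs using fun i => exists_continuous_section (η i) (hηs i)
  choose f hf using fun i : kerIndex η ρ => exists_cocycle (θ i) (s i) (hs i)
  -- On the whole kernel of the fiber product, `ε` is the finite sum of its restrictions: `x` is
  -- compared with its truncation `y` to the support, and `y⁻¹ * x` lives only on factors killed by
  -- `ε`.
  have hker : ∀ (x : fiberProd η), fiberProdMap η x = 1 → ∀ u : kerIndex η ρ → A,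
      (∀ i : kerIndex η ρ, fiberProdProj η (i : I) x = (θ i).incl (u i)) →
      ε x = θ₀.incl (∑ i ∈ a'.support, a i • u i) := by
    intro x hx u hu
    have key : ∀ F : Finset (kerIndex η ρ), ∃ y, fiberProdMap η y = 1 ∧
        (∀ i ∈ F, fiberProdProj η (i : I) y = fiberProdProj η (i : I) x) ∧
        (∀ i : kerIndex η ρ, i ∉ F → fiberProdProj η (i : I) y = 1) ∧
        ε y = θ₀.incl (∑ i ∈ F, a i • u i) := by
      intro F
      induction F using Finset.induction_on with
      | empty => exact ⟨1, by simp⟩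
      | insert j F hj ih =>
        obtain ⟨y, hy1, hy2, hy3, hy4⟩ := ih
        have hxj : η j (fiberProdProj η j x) = 1 := (map_fiberProdProj _ x).trans hx
        refine ⟨fiberProdSingle η j ⟨fiberProdProj η j x, hxj⟩ * y, by simp [hy1], ?_, ?_, ?_⟩
        · intro i hi
          rcases Finset.mem_insert.mp hi with rfl | hi
          · simp [hy3 i hj]
          · have hij : (i : I) ≠ j := fun h => hj (Subtype.ext h ▸ hi)
            simp [hy2 i hi, fiberProdProj_single_ne hij]
        · intro i hi
          rw [Finset.mem_insert, not_or] at hi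
          have hij : (i : I) ≠ j := fun h => hi.1 (Subtype.ext h)
          simp [hy3 i hi.2, fiberProdProj_single_ne hij]
        · rw [map_mul, hy4, ha, Finset.sum_insert hj, θ₀.incl_add, ((θ j).apply_ofMul _).mpr (hu j)]
    obtain ⟨y, hy1, hy2, -, hy4⟩ := key a'.support
    rw [← hy4]
    have h1 := eq_one_of_forall_fiberProdSingle ε {i | ∀ k, ε (fiberProdSingle η i k) = 1}
      (fun i hi => hi) (y⁻¹ * x) (by simp [hx, hy1]) fun i hi => by
        have hi' : ∃ k, ε (fiberProdSingle η i k) ≠ 1 := not_forall.mp hi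
        obtain ⟨k, hk⟩ := hi'
        have hiA := mem_kerIndex_of_ne_one hη hζ hε hc θ₀ hk
        rw [map_mul, map_inv, inv_mul_eq_one]
        refine hy2 ⟨i, hiA⟩ (Finsupp.mem_support_iff.mpr fun h0 => hk ?_)
        rw [ha ⟨i, hiA⟩ k, show a ⟨i, hiA⟩ = 0 from h0]
        simp
    rw [map_mul, map_inv, inv_mul_eq_one] at h1
    exact h1.symm
  refine ⟨⟨i, hi⟩, fun i => Submodule.Quotient.mk (f i),
    fun i => (isExtensionClass_iff _).mpr ⟨s i, hs i, f i, hf i, rfl⟩, a', ha', ?_⟩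
  refine IsExtensionClass.unique θ₀ ?_ hz
  -- The sections of all factors, including those outside `kerIndex η ρ`, assemble to a section of
  -- the fiber product. Its image under `ε` is a section of `ζ`, with cocycle computed by `hker`.
  let S : G → fiberProd η := fun g => ⟨(g, fun i => s i g), fun i => hs i g⟩
  have hS : Continuous S := continuous_fiberProd continuous_id fun i => (s i).continuous
  refine (isExtensionClass_iff _).mpr ⟨⟨fun g => ε (S g), ε.continuous_toFun.comp hS⟩,
    fun g => hc _, Finsupp.linearCombination (endRing ρ) f a', fun σ τ => ?_,
    (H2.linearCombination_mk f a').symm⟩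
  have h1 := hker (S σ * S τ * (S (σ * τ))⁻¹) 
    (by
      rw [map_mul, map_mul, map_inv]
      exact mul_inv_cancel (σ * τ))
    (fun i => (f i).1 (σ, τ)) fun i => mul_inv_eq_iff_eq_mul.mpr (hf i σ τ)
  rw [Z2.linearCombination_apply]
  refine Eq.trans ?_ (congrArg (· * ε (S (σ * τ))) h1)
  simp

/-- A homomorphism from the fiber product to an indecomposable cover is surjective if its image
contains the image of a nonzero endomorphism of the kernel. -/
theorem surjective_of_incl_smul_mem_range (hη : ∀ i, Function.Surjective (η i))
    (hζ : Indecomposable ζ) (hc : ∀ x, ζ (ε x) = fiberProdMap η x) (θ₀ : KerEquiv (ζ : E →* G) ρ)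
    {a : endRing ρ} (ha0 : a ≠ 0) (ha : ∀ b, ∃ x, ε x = θ₀.incl (a • b)) :
    Function.Surjective ε := by
  have := hζ.finite_ker
  -- The image of `a`, a nonzero `G`-submodule of the kernel; minimality makes it the whole kernel.
  let N : Subgroup E :=
    { carrier := {e | ∃ b, θ₀.incl (a • b) = e}
      mul_mem' := by
        rintro _ _ ⟨b, rfl⟩ ⟨c, rfl⟩
        exact ⟨b + c, by rw [smul_add, θ₀.incl_add]⟩
      one_mem' := ⟨0, by simp⟩
      inv_mem' := by
        rintro _ ⟨b, rfl⟩
        exact ⟨-b, by rw [eq_inv_iff_mul_eq_one, ← θ₀.incl_add, ← smul_add]; simp⟩ }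
  have hN : N.Normal := by
    refine ⟨?_⟩
    rintro _ ⟨b, rfl⟩ e
    refine ⟨ρ (ζ e) b, ?_⟩
    have := θ₀.mul_incl e (a • b)
    rw [this, mul_inv_cancel_right, endRing_comm]
    rfl
  have hle : N ≤ (ζ : E →* G).ker := by
    rintro _ ⟨b, rfl⟩
    exact θ₀.map_incl _
  have hNf : (N : Set E).Finite := (Set.toFinite ((ζ : E →* G).ker : Set E)).subset hle
  have hNe : N = (ζ : E →* G).ker := by
    refine (((indecomposable_iff ζ).mp hζ).2.2 N hN hNf.isClosed hle).resolve_left fun h => ha0 ?_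
    refine Subtype.ext (LinearMap.ext fun b => θ₀.incl_eq_one ?_)
    have : θ₀.incl (a • b) ∈ N := ⟨b, rfl⟩
    rwa [h, Subgroup.mem_bot] at this
  intro e
  obtain ⟨x, hx⟩ := fiberProdMap_surjective hη (ζ e)
  have h1 : e * (ε x)⁻¹ ∈ N := by
    rw [hNe]
    change ζ (e * (ε x)⁻¹) = 1
    rw [map_mul, map_inv, hc, hx, mul_inv_cancel]
  obtain ⟨b, hb⟩ := h1
  obtain ⟨x', hx'⟩ := ha b
  have hxb : ε x' = e * (ε x)⁻¹ := hx'.trans hb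
  exact ⟨x' * x, by rw [map_mul, hxb, inv_mul_cancel_right]⟩

/-- Sections `s i` with cocycles `f i` and a section `s'` with cocycle `∑ a i • f i` give rise to a
homomorphism from the fiber product, which is `∑ a i` on the kernels. -/
theorem exists_hom_of_cocycle [∀ i, Finite (η i : H i →* G).ker] (θ₀ : KerEquiv (ζ : E →* G) ρ)
    (θ : ∀ i : kerIndex η ρ, KerEquiv (η i : H i →* G) ρ) (s : ∀ i : kerIndex η ρ, C(G, H i))
    (hs : ∀ (i : kerIndex η ρ) σ, η i (s i σ) = σ) (f : kerIndex η ρ → Z2 ρ)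
    (hf : ∀ i σ τ, s i σ * s i τ = (θ i).incl ((f i).1 (σ, τ)) * s i (σ * τ))
    (S : Finset (kerIndex η ρ)) (a : kerIndex η ρ → endRing ρ) (s' : G → E) (hs'c : Continuous s')
    (hs' : ∀ σ, ζ (s' σ) = σ)
    (hs'f : ∀ σ τ, s' σ * s' τ = θ₀.incl (∑ i ∈ S, a i • (f i).1 (σ, τ)) * s' (σ * τ)) :
    ∃ ε : fiberProd η →ₜ* E, (∀ x, ζ (ε x) = fiberProdMap η x) ∧
      ∀ j ∈ S, ∀ b, ∃ x, ε x = θ₀.incl (a j • b) := by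
  classical
  -- The module coordinate `u i` of the `i`-th component relative to the section `s i`. By `hu2` its
  -- failure to be a crossed homomorphism is the cocycle `f i`.
  choose u hu using fun i : kerIndex η ρ => exists_locallyConstant (θ i)
    (fun x : fiberProd η => fiberProdProj η (i : I) x * (s i (fiberProdMap η x))⁻¹)
    ((fiberProdProj η (i : I)).continuous_toFun.mul
      ((s i).continuous.comp (fiberProdMap η).continuous_toFun).inv)
    (fun x => by simp [map_fiberProdProj, hs])
  have hu' : ∀ (i : kerIndex η ρ) x,
      fiberProdProj η (i : I) x = (θ i).incl (u i x) * s i (fiberProdMap η x) :=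
    fun i x => mul_inv_eq_iff_eq_mul.mp (hu i x)
  have hu2 : ∀ (i : kerIndex η ρ) x x', u i (x * x') = u i x + ρ (fiberProdMap η x) (u i x') +
      (f i).1 (fiberProdMap η x, fiberProdMap η x') := fun i x x' => by
    refine (θ i).incl_injective ?_
    rw [← mul_left_inj (s i (fiberProdMap η (x * x'))), ← hu', map_mul, hu', hu', (θ i).incl_add,
      (θ i).incl_add, map_mul, mul_assoc _ _ (s i _), ← hf, mul_assoc, ← mul_assoc (s i _),
      section_mul_incl (θ i) (hs i)]
    simp only [mul_assoc]
  let U : LocallyConstant (fiberProd η) A := ∑ i ∈ S, a i • u i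
  have hU : ∀ x, U x = ∑ i ∈ S, a i • u i x := fun x =>
    map_sum (LocallyConstant.evalAddMonoidHom x) _ _
  -- The defect of `U` as a crossed homomorphism is the cocycle of `s'`, so the product is
  -- multiplicative. Continuity needs no topology on `A`, since `U` is locally constant.
  let ε : fiberProd η →ₜ* E :=
    { MonoidHom.mk' (fun x => θ₀.incl (U x) * s' (fiberProdMap η x)) (fun x x' => by
        have h1 : U (x * x') = U x + (ρ (fiberProdMap η x) (U x') +
            ∑ i ∈ S, a i • (f i).1 (fiberProdMap η x, fiberProdMap η x')) := by
          simp only [hU, hu2, smul_add, Finset.sum_add_distrib, map_sum, endRing_comm, add_assoc]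
        rw [h1, θ₀.incl_add, θ₀.incl_add, map_mul, mul_assoc, mul_assoc, ← hs'f,
          ← mul_assoc (θ₀.incl (ρ _ _)), ← section_mul_incl θ₀ hs']
        simp only [mul_assoc]) with
      continuous_toFun := (U.isLocallyConstant.comp θ₀.incl).continuous.mul
        (hs'c.comp (fiberProdMap η).continuous_toFun) }
  have hε : ∀ x, ε x = θ₀.incl (U x) * s' (fiberProdMap η x) := fun x => rfl
  have hζε : ∀ x, ζ (ε x) = fiberProdMap η x := fun x => by
    have : ζ (θ₀.incl (U x)) = 1 := θ₀.map_incl _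
    rw [hε, map_mul, this, one_mul, hs']
  refine ⟨ε, hζε, fun j hj b => ?_⟩
  let k : (η j : H j →* G).ker := ((θ j).toAddEquiv.symm b).toMul
  -- The term `u i 1` appears because the sections need not be normalized at 1. It cancels at the
  -- end against `s' 1`, by `ε 1 = 1`.
  have hk : ∀ i, u i (fiberProdSingle η j k) = (if i = j then b else 0) + u i 1 := fun i => by
    refine (θ i).incl_injective ?_
    rw [← mul_left_inj (s i 1), (θ i).incl_add, mul_assoc]
    have h1 := hu' i (fiberProdSingle η j k)
    have h2 := hu' i 1
    rw [fiberProdMap_single] at h1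
    rw [map_one (fiberProdProj η (i : I)), map_one (fiberProdMap η)] at h2
    rw [← h1, ← h2, mul_one]
    by_cases hij : i = j
    · subst hij
      rw [fiberProdProj_single_same, if_pos rfl]
      rfl
    · rw [if_neg hij, (θ i).incl_zero, fiberProdProj_single_ne fun h => hij (Subtype.ext h)]
  refine ⟨fiberProdSingle η j k, ?_⟩
  have h1 : U (fiberProdSingle η j k) = a j • b + U 1 := by
    simp only [hU, hk, smul_add, Finset.sum_add_distrib]
    congr 1
    rw [Finset.sum_eq_single j (fun i _ hij => by rw [if_neg hij, smul_zero])
      (fun h => absurd hj h), if_pos rfl]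
  have h2 : ε 1 = 1 := map_one ε
  rw [hε, map_one (fiberProdMap η)] at h2
  rw [hε, h1, θ₀.incl_add, fiberProdMap_single, mul_assoc, h2, mul_one]

/-- A cover of `G` is dominated by the fiber product if its class is a nontrivial linear combination
of classes of the factors. -/
theorem exists_dominated_of_isNontrivialCombinationOfCovers (hη : ∀ i, Indecomposable (η i))
    (hζ : Indecomposable ζ) (θ₀ : KerEquiv (ζ : E →* G) ρ)
    (θ : ∀ i : kerIndex η ρ, KerEquiv (η i : H i →* G) ρ) {z : H2 ρ}
    (hz : IsExtensionClass ζ θ₀ z) (hzc : IsNontrivialCombinationOfCovers η θ z) :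
    ∃ ε : fiberProd η →ₜ* E, Function.Surjective ε ∧ ∀ x, ζ (ε x) = fiberProdMap η x := by
  classical
  have := hζ.finite_ker
  have := fun i => (hη i).finite_ker
  have hηs := fun i => (hη i).surjective
  obtain ⟨x, hx, a, ha, rfl⟩ := hzc
  choose s hs f hf hfx using fun i => (isExtensionClass_iff _).mp (hx i)
  obtain rfl : (fun i => Submodule.Quotient.mk (f i)) = x := funext hfx
  obtain ⟨t, ht, F, hF, hFa⟩ := (isExtensionClass_iff _).mp hz
  rw [H2.linearCombination_mk] at hFa
  obtain ⟨y, hy⟩ := (Submodule.Quotient.eq _).mp hFa.symm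
  -- `s'` is a section whose cocycle is the linear combination of the cocycles `f i`
  let s' : G → E := fun σ => θ₀.incl (y σ) * t σ
  have hs' : ∀ σ, ζ (s' σ) = σ := fun σ => by
    have : ζ (θ₀.incl (y σ)) = 1 := θ₀.map_incl _
    simp [s', this, ht]
  have hs'c : Continuous s' := (y.isLocallyConstant.comp θ₀.incl).continuous.mul t.continuous
  have hs'f : ∀ σ τ, s' σ * s' τ =
      θ₀.incl (∑ i ∈ a.support, a i • (f i).1 (σ, τ)) * s' (σ * τ) := fun σ τ => by
    rw [cocycle_change θ₀ ht (fun σ => rfl) hF σ τ, ← hy σ τ, ← Z2.linearCombination_apply]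
    congr 2
    exact add_sub_cancel _ _
  obtain ⟨ε, hc, hε⟩ := exists_hom_of_cocycle θ₀ θ s hs f hf a.support a s' hs'c hs' hs'f
  obtain ⟨j, hj⟩ := Finsupp.ne_iff.mp ha
  exact ⟨ε, surjective_of_incl_smul_mem_range hηs hζ hc θ₀ hj
    (hε j (Finsupp.mem_support_iff.mpr hj)), hc⟩

end Combination

/-! ### Inflation of covers and of their classes -/

section Pullback

variable {G D E : Type*} [Group G] [TopologicalSpace G] [IsTopologicalGroup G] [CompactSpace G]
  [TotallyDisconnectedSpace G] [Group D] [TopologicalSpace D] [IsTopologicalGroup D]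
  [T2Space D] [Group E] [TopologicalSpace E]
  [IsTopologicalGroup E] [CompactSpace E] [TotallyDisconnectedSpace E]
  {π : G →ₜ* D} {ζ : E →ₜ* D}

theorem compactSpace_pullback : CompactSpace (pullback π ζ) := by
  have : IsClosed (pullback π ζ : Set (G × E)) :=
    isClosed_eq (π.continuous_toFun.comp continuous_fst) (ζ.continuous_toFun.comp continuous_snd)
  exact isCompact_iff_compactSpace.mp this.isCompact

/-- The kernel of the inflation projects isomorphically onto the kernel of `ζ`. Surjectivity of `π`
makes `G ×_D E → E` surjective, so normal subgroups have normal images and minimality carries over.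
-/
theorem indecomposable_coverInflation (hπ : Function.Surjective π) (hζ : Indecomposable ζ) :
    Indecomposable (coverInflation π ζ) := by
  have := compactSpace_pullback (π := π) (ζ := ζ)
  have := hζ.finite_ker
  obtain ⟨hs, hi, hm⟩ := (indecomposable_iff ζ).mp hζ
  refine (indecomposable_iff _).mpr ⟨fun g => ?_, fun h => hi ?_, fun N hN _ hle => ?_⟩
  · obtain ⟨e, he⟩ := hs (π g)
    exact ⟨⟨(g, e), he.symm⟩, rfl⟩
  · refine (injective_iff_map_eq_one _).mpr fun e he => ?_
    have h1 : (⟨(1, e), (map_one π).trans he.symm⟩ : pullback π ζ) = 1 := h rfl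
    exact congrArg (fun x => x.1.2) h1
  · have hN1 : ∀ x ∈ N, x.1.1 = 1 := fun x hx => hle hx
    let p : pullback π ζ →* E := (MonoidHom.snd G E).comp (pullback π ζ).subtype
    have hp : Function.Surjective p := fun e => by
      obtain ⟨g, hg⟩ := hπ (ζ e)
      exact ⟨⟨(g, e), hg⟩, rfl⟩
    have hle' : N.map p ≤ (ζ : E →* D).ker := by
      rintro _ ⟨x, hx, rfl⟩
      have h1 : π x.1.1 = ζ x.1.2 := x.2
      rw [hN1 x hx, map_one] at h1
      exact h1.symm
    have hf : (N.map p : Set E).Finite :=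
      (Set.toFinite ((ζ : E →* D).ker : Set E)).subset hle'
    rcases hm (N.map p) (hN.map p hp) hf.isClosed hle' with h | h
    · left
      refine (Subgroup.eq_bot_iff_forall N).mpr fun x hx => Subtype.ext (Prod.ext (hN1 x hx) ?_)
      have : x.1.2 ∈ N.map p := ⟨x, hx, rfl⟩
      rwa [h, Subgroup.mem_bot] at this
    · right
      refine le_antisymm hle fun x (hx : x.1.1 = 1) => ?_
      have h1 : π x.1.1 = ζ x.1.2 := x.2
      rw [hx, map_one] at h1
      have h2 : x.1.2 ∈ N.map p := by
        rw [h]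
        exact h1.symm
      obtain ⟨x', hx', hxx'⟩ := h2
      rwa [show x = x' from Subtype.ext (Prod.ext (hx.trans (hN1 x' hx').symm) hxx'.symm)]

/-- The kernel of the inflation of a cover is the kernel of the cover. -/
def kerInflation (π : G →ₜ* D) (ζ : E →ₜ* D) :
    (coverInflation π ζ : pullback π ζ →* G).ker ≃* (ζ : E →* D).ker where
  toFun x := ⟨x.1.1.2, by
    have h1 : π x.1.1.1 = ζ x.1.1.2 := x.1.2
    have h2 : x.1.1.1 = 1 := x.2
    rw [h2, map_one] at h1
    exact h1.symm⟩
  invFun c := ⟨⟨(1, c), (map_one π).trans c.2.symm⟩, rfl⟩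
  left_inv x := Subtype.ext (Subtype.ext (Prod.ext (Eq.symm x.2) rfl))
  right_inv _ := rfl
  map_mul' _ _ := rfl

variable {A : Type*} [AddCommGroup A] {ρ : Representation ℤ D A}

/-- Inflation of an identification of the kernel of a cover with a module. -/
def KerEquiv.inflation (π : G →ₜ* D) (θ : KerEquiv (ζ : E →* D) ρ) :
    KerEquiv (coverInflation π ζ : pullback π ζ →* G) (infRep π ρ) where
  toAddEquiv := (MulEquiv.toAdditive (kerInflation π ζ)).trans θ.toAddEquiv
  map_conj h x := by
    have h1 := θ.map_conj h.1.2 (kerInflation π ζ x)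
    have h2 : (ζ : E →* D) h.1.2 = π h.1.1 := Eq.symm h.2
    rw [h2] at h1
    exact h1

/-- A section `s` of `ζ` induces the section `g ↦ (g, s (π g))`, whose cocycle is the inflated one.
-/
theorem IsExtensionClass.inflation (π : G →ₜ* D) {θ : KerEquiv (ζ : E →* D) ρ} {z : H2 ρ}
    (hz : IsExtensionClass ζ θ z) :
    IsExtensionClass (coverInflation π ζ) (θ.inflation π) (infH2 π ρ z) := by
  have := compactSpace_pullback (π := π) (ζ := ζ)
  obtain ⟨s, hs, f, hf, rfl⟩ := (isExtensionClass_iff θ).mp hz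
  refine (isExtensionClass_iff _).mpr ⟨⟨fun g => ⟨(g, s (π g)), (hs _).symm⟩,
    (continuous_id.prodMk (s.continuous.comp π.continuous_toFun)).subtype_mk _⟩, fun g => rfl,
    infZ2 π ρ f, fun σ τ => Subtype.ext (Prod.ext (one_mul (σ * τ)).symm ?_), rfl⟩
  have h := hf (π σ) (π τ)
  rw [← map_mul π] at h
  exact h

end Pullback

/-! ### The criteria over `G` and the passage to semi-cartesian squares -/

section Main

variable {I G : Type*} [Group G] [TopologicalSpace G] [IsTopologicalGroup G] [CompactSpace G]
  [TotallyDisconnectedSpace G] {H : I → Type*} [∀ i, Group (H i)] [∀ i, TopologicalSpace (H i)]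
  [∀ i, IsTopologicalGroup (H i)] [∀ i, CompactSpace (H i)] [∀ i, TotallyDisconnectedSpace (H i)]
  {η : ∀ i, H i →ₜ* G}
  {E : Type*} [Group E] [TopologicalSpace E] [IsTopologicalGroup E] [CompactSpace E]
  [TotallyDisconnectedSpace E]

theorem exists_dominated_iff_of_not_isMulCommutative (hη : ∀ i, Indecomposable (η i))
    {ζ : E →ₜ* G} (hζ : Indecomposable ζ) (hC : ¬ IsMulCommutative (ζ : E →* G).ker) :
    (∃ ε : fiberProd η →ₜ* E, Function.Surjective ε ∧ ∀ x, ζ (ε x) = fiberProdMap η x) ↔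
      {i | CoverIso (η i) ζ}.Nonempty := by
  constructor
  · rintro ⟨ε, hε, hc⟩
    obtain ⟨j, e, -, he⟩ := exists_factor_of_not_isMulCommutative hη hζ hε hc hC
    exact ⟨j, e, he⟩
  · rintro ⟨i, hi⟩
    exact exists_dominated_of_coverIso (fun i => (hη i).surjective) hi

theorem exists_dominated_iff_of_kerEquiv (hη : ∀ i, Indecomposable (η i))
    {ζ : E →ₜ* G} (hζ : Indecomposable ζ) {A : Type*} [AddCommGroup A] {ρ : Representation ℤ G A}
    (θ₀ : KerEquiv (ζ : E →* G) ρ) (θ : ∀ i : kerIndex η ρ, KerEquiv (η i : H i →* G) ρ)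
    {z : H2 ρ} (hz : IsExtensionClass ζ θ₀ z) :
    (∃ ε : fiberProd η →ₜ* E, Function.Surjective ε ∧ ∀ x, ζ (ε x) = fiberProdMap η x) ↔
      (kerIndex η ρ).Nonempty ∧ IsNontrivialCombinationOfCovers η θ z := by
  constructor
  · rintro ⟨ε, hε, hc⟩
    exact isNontrivialCombinationOfCovers_of_dominated hη hζ hε hc θ₀ θ hz
  · rintro ⟨-, h⟩
    exact exists_dominated_of_isNontrivialCombinationOfCovers hη hζ θ₀ θ hz h

variable {D : Type*} [Group D] [TopologicalSpace D] {π : G →ₜ* D} {ζ : E →ₜ* D}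

/-- The homomorphism to `G ×_D E` given by a commutative square. -/
def pullbackLift {X : Type*} [Group X] [TopologicalSpace X] (β : X →ₜ* G) (ε : X →ₜ* E)
    (h : ∀ x, π (β x) = ζ (ε x)) : X →ₜ* pullback π ζ where
  toFun x := ⟨(β x, ε x), h x⟩
  map_one' := Subtype.ext (Prod.ext (map_one β) (map_one ε))
  map_mul' x y := Subtype.ext (Prod.ext (map_mul β x y) (map_mul ε x y))
  continuous_toFun := (β.continuous_toFun.prodMk ε.continuous_toFun).subtype_mk _

theorem IsSemiCartesian.pullbackLift_surjective {X : Type*} [Group X] [TopologicalSpace X]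
    {β : X →ₜ* G} {ε : X →ₜ* E} (h : IsSemiCartesian ε β ζ π) :
    Function.Surjective (pullbackLift β ε h.comm) := by
  rintro ⟨⟨g, e⟩, hge⟩
  obtain ⟨x, rfl, rfl⟩ := h.exists_lift g e hge
  exact ⟨x, rfl⟩

theorem pullback_snd_surjective (hπ : Function.Surjective π) :
    Function.Surjective fun x : pullback π ζ => x.1.2 := fun e => by
  obtain ⟨g, hg⟩ := hπ (ζ e)
  exact ⟨⟨(g, e), hg⟩, rfl⟩

/-- The projection of `G ×_D E` on `E`. -/
def pullbackSnd (π : G →ₜ* D) (ζ : E →ₜ* D) : pullback π ζ →ₜ* E where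
  toFun x := x.1.2
  map_one' := rfl
  map_mul' _ _ := rfl
  continuous_toFun := by fun_prop

/-- The lifting property of a semi-cartesian square says precisely that the induced map to `G ×_D E`
is surjective. -/
theorem exists_isSemiCartesian_iff {X : Type*} [Group X] [TopologicalSpace X]
    (β : X →ₜ* G) (hπ : Function.Surjective π) :
    (∃ ε : X →ₜ* E, Function.Surjective ε ∧ IsSemiCartesian ε β ζ π) ↔
      ∃ ε : X →ₜ* pullback π ζ, Function.Surjective ε ∧ ∀ x, coverInflation π ζ (ε x) = β x := by
  constructor
  · rintro ⟨ε, -, h⟩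
    exact ⟨_, h.pullbackLift_surjective, fun x => rfl⟩
  · rintro ⟨ε, hε, h⟩
    refine ⟨(pullbackSnd π ζ).comp ε, (pullback_snd_surjective hπ).comp hε, fun x => ?_,
      fun g e hge => ?_⟩
    · rw [← h]
      exact (ε x).2
    · obtain ⟨x, hx⟩ := hε ⟨(g, e), hge⟩
      refine ⟨x, ?_, ?_⟩
      · rw [← h, hx]
        rfl
      · change (ε x).1.2 = e
        rw [hx]

end Main

end ProfiniteCover

/-- Indecomposable covers dominated by a fiber product of indecomposable covers: first over an
epimorphism `π : G → D`, then the case `π = id`. The family `θ` is any choice of identifications of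
the kernels `Ker (η i) ≅ C` of `G`-modules; it serves to regard these `η i` as elements of
`H²(G, C)`. -/
theorem mainTheorem1 {I : Type*} {G : Type*} [Group G] [TopologicalSpace G] [IsTopologicalGroup G]
    [CompactSpace G] [TotallyDisconnectedSpace G]
    {H : I → Type*} [∀ i, Group (H i)] [∀ i, TopologicalSpace (H i)]
    [∀ i, IsTopologicalGroup (H i)] [∀ i, CompactSpace (H i)]
    [∀ i, TotallyDisconnectedSpace (H i)]
    (η : ∀ i, H i →ₜ* G) (hη : ∀ i, Indecomposable (η i)) :
    (∀ (D : Type*) [Group D] [TopologicalSpace D] [IsTopologicalGroup D]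
        [CompactSpace D] [TotallyDisconnectedSpace D]
        (E : Type*) [Group E] [TopologicalSpace E] [IsTopologicalGroup E]
        [CompactSpace E] [TotallyDisconnectedSpace E]
        (π : G →ₜ* D) (_ : Function.Surjective π) (ζ : E →ₜ* D) (hζ : Indecomposable ζ)
        (θ : ∀ (_ : IsMulCommutative (ζ : E →* D).ker) (i : kerIndex η (infRep π hζ.kerRep)),
          KerEquiv (η i : H i →* G) (infRep π hζ.kerRep)),
      ((∃ ε : fiberProd η →ₜ* E, Function.Surjective ε ∧
          IsSemiCartesian ε (fiberProdMap η) ζ π) ↔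
        Xor
          (¬ IsMulCommutative (ζ : E →* D).ker ∧
            {i | CoverIso (η i) (coverInflation π ζ)}.Nonempty)
          (∃ hC : IsMulCommutative (ζ : E →* D).ker,
            (kerIndex η (infRep π hζ.kerRep)).Nonempty ∧
            ∃ z : H2 hζ.kerRep,
              IsExtensionClass ζ (KerEquiv.refl (ζ : E →* D) hζ.surjective) z ∧
              IsNontrivialCombinationOfCovers η (θ hC) (infH2 π hζ.kerRep z))) ∧
      ∀ ε : fiberProd η →ₜ* E, Function.Surjective ε →
        IsSemiCartesian ε (fiberProdMap η) ζ π →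
        (¬ IsMulCommutative (ζ : E →* D).ker →
          (∃! j, (fiberProdProj η j : fiberProd η →* H j).ker =
            (ε : fiberProd η →* E).ker ⊓ (fiberProdMap η : fiberProd η →* G).ker) ∧
          ∀ j, (fiberProdProj η j : fiberProd η →* H j).ker =
            (ε : fiberProd η →* E).ker ⊓ (fiberProdMap η : fiberProd η →* G).ker →
            CoverIso (η j) (coverInflation π ζ) ∧
            ∃ εj : H j →ₜ* E, Function.Surjective εj ∧
              (∀ h, εj (fiberProdProj η j h) = ε h) ∧ IsCartesian εj (η j) ζ π) ∧
        (∀ _ : IsMulCommutative (ζ : E →* D).ker,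
          ∃ ε' : fiberProd (fun i : kerIndex η (infRep π hζ.kerRep) => η i) →ₜ* E,
            Function.Surjective ε' ∧
            ∀ h, ε' (fiberProdRestrict η (kerIndex η (infRep π hζ.kerRep)) h) = ε h)) ∧
    (∀ (E : Type*) [Group E] [TopologicalSpace E] [IsTopologicalGroup E]
        [CompactSpace E] [TotallyDisconnectedSpace E]
        (ζ : E →ₜ* G) (hζ : Indecomposable ζ)
        (θ : ∀ (_ : IsMulCommutative (ζ : E →* G).ker) (i : kerIndex η hζ.kerRep),
          KerEquiv (η i : H i →* G) hζ.kerRep),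
      ((∃ ε : fiberProd η →ₜ* E, Function.Surjective ε ∧ ∀ h, ζ (ε h) = fiberProdMap η h) ↔
        Xor
          (¬ IsMulCommutative (ζ : E →* G).ker ∧ {i | CoverIso (η i) ζ}.Nonempty)
          (∃ hC : IsMulCommutative (ζ : E →* G).ker,
            (kerIndex η hζ.kerRep).Nonempty ∧
            ∃ z : H2 hζ.kerRep,
              IsExtensionClass ζ (KerEquiv.refl (ζ : E →* G) hζ.surjective) z ∧
              IsNontrivialCombinationOfCovers η (θ hC) z)) ∧
      ∀ ε : fiberProd η →ₜ* E, Function.Surjective ε →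
        (∀ h, ζ (ε h) = fiberProdMap η h) →
        (¬ IsMulCommutative (ζ : E →* G).ker →
          (∃! j, (ε : fiberProd η →* E).ker = (fiberProdProj η j : fiberProd η →* H j).ker) ∧
          ∀ j, (ε : fiberProd η →* E).ker = (fiberProdProj η j : fiberProd η →* H j).ker →
            CoverIso (η j) ζ ∧
            ∃ εj : H j ≃ₜ* E, (∀ h, εj (fiberProdProj η j h) = ε h) ∧
              ∀ h, ζ (εj h) = η j h) ∧
        (∀ _ : IsMulCommutative (ζ : E →* G).ker,
          ∃ ε' : fiberProd (fun i : kerIndex η hζ.kerRep => η i) →ₜ* E,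
            Function.Surjective ε' ∧
            (∀ h, ε' (fiberProdRestrict η (kerIndex η hζ.kerRep) h) = ε h) ∧
            ∀ h, ζ (ε' h) = fiberProdMap (fun i : kerIndex η hζ.kerRep => η i) h)) := by
  
  constructor
  · intro D _ _ _ _ _ E _ _ _ _ _ π hπ ζ hζ θ
    have := hζ.finite_ker
    have := compactSpace_pullback (π := π) (ζ := ζ)
    have hζ' := indecomposable_coverInflation hπ hζ
    have hcomm : ¬ IsMulCommutative (ζ : E →* D).ker →
        ¬ IsMulCommutative (coverInflation π ζ : pullback π ζ →* G).ker := fun hC h => hC <| by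
      refine isMulCommutative_iff.mpr fun a b => (kerInflation π ζ).symm.injective ?_
      rw [map_mul, map_mul, mul_comm']
    refine ⟨?_, fun ε hε hsc => ⟨fun hC => ?_, fun hC => ?_⟩⟩
    · rw [exists_isSemiCartesian_iff _ hπ]
      by_cases hC : IsMulCommutative (ζ : E →* D).ker
      · obtain ⟨z, hz⟩ := exists_isExtensionClass (KerEquiv.refl (ζ : E →* D) hζ.surjective)
          hζ.surjective
        rw [exists_dominated_iff_of_kerEquiv hη hζ' _ (θ hC) (hz.inflation π)]
        -- The two alternatives exclude each other through commutativity of the kernel. In the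
        -- converse, uniqueness of the class identifies the given `z'` with `z`.
        refine ⟨fun h => Or.inr ⟨⟨hC, h.1, z, hz, h.2⟩, fun h' => h'.1 hC⟩, ?_⟩
        rintro (⟨⟨h, -⟩, -⟩ | ⟨⟨_, hne, z', hz', h⟩, -⟩)
        · exact absurd hC h
        · rw [hz.unique _ hz']
          exact ⟨hne, h⟩
      · rw [exists_dominated_iff_of_not_isMulCommutative hη hζ' (hcomm hC)]
        refine ⟨fun h => Or.inl ⟨⟨hC, h⟩, fun h' => hC h'.1⟩, ?_⟩
        rintro (⟨⟨-, h⟩, -⟩ | ⟨⟨h, -⟩, -⟩)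
        · exact h
        · exact absurd h hC
    · obtain ⟨j, e, he, hζe⟩ := exists_factor_of_not_isMulCommutative hη hζ'
        hsc.pullbackLift_surjective (fun x => rfl) (hcomm hC)
      have hker : (fiberProdProj η j : fiberProd η →* H j).ker =
          (ε : fiberProd η →* E).ker ⊓ (fiberProdMap η : fiberProd η →* G).ker := by
        ext x
        have h1 : fiberProdProj η j x = 1 ↔ pullbackLift (fiberProdMap η) ε hsc.comm x = 1 := by
          rw [← he, map_eq_one_iff e e.injective]
        refine h1.trans ⟨fun h => ⟨?_, ?_⟩, fun h => Subtype.ext (Prod.ext h.2 h.1)⟩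
        · exact congrArg (fun y : pullback π ζ => y.1.2) h
        · exact congrArg (fun y : pullback π ζ => y.1.1) h
      have huniq : ∀ i, (fiberProdProj η i : fiberProd η →* H i).ker =
          (ε : fiberProd η →* E).ker ⊓ (fiberProdMap η : fiberProd η →* G).ker → i = j :=
        fun i hi => fiberProdProj_ker_injective hη (hi.trans hker.symm).le
      refine ⟨⟨j, hker, huniq⟩, fun i hi => ?_⟩
      obtain rfl := huniq i hi
      refine ⟨⟨e, hζe⟩, (pullbackSnd π ζ).comp ⟨e, e.continuous_toFun⟩,
        (pullback_snd_surjective hπ).comp e.surjective, fun x => congrArg (fun y => y.1.2) (he x),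
        fun h => ?_, fun g c hgc => ?_⟩
      · rw [← hζe]
        exact (e h).2
      -- The square is cartesian because `e` identifies `H i` with `G ×_D E`.
      · refine ⟨e.symm ⟨(g, c), hgc⟩, ⟨?_, ?_⟩, ?_⟩
        · rw [← hζe, e.apply_symm_apply]
          rfl
        · change (e (e.symm _)).1.2 = c
          rw [e.apply_symm_apply]
        · rintro y ⟨hy1, hy2⟩
          rw [e.eq_symm_apply]
          exact Subtype.ext (Prod.ext ((hζe y).trans hy1) hy2)
    · obtain ⟨ε', hε', h1, -⟩ := exists_factor_kerIndex hη hζ' hsc.pullbackLift_surjective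
        (fun x => rfl) ((KerEquiv.refl (ζ : E →* D) hζ.surjective).inflation π)
      exact ⟨(pullbackSnd π ζ).comp ε', (pullback_snd_surjective hπ).comp hε',
        fun x => congrArg (fun y => y.1.2) (h1 x)⟩
  · intro E _ _ _ _ _ ζ hζ θ
    have := hζ.finite_ker
    refine ⟨?_, fun ε hε hc => ⟨fun hC => ?_, fun hC => ?_⟩⟩
    · by_cases hC : IsMulCommutative (ζ : E →* G).ker
      · obtain ⟨z, hz⟩ := exists_isExtensionClass (KerEquiv.refl (ζ : E →* G) hζ.surjective)
          hζ.surjective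
        rw [exists_dominated_iff_of_kerEquiv hη hζ _ (θ hC) hz]
        refine ⟨fun h => Or.inr ⟨⟨hC, h.1, z, hz, h.2⟩, fun h' => h'.1 hC⟩, ?_⟩
        rintro (⟨⟨h, -⟩, -⟩ | ⟨⟨_, hne, z', hz', h⟩, -⟩)
        · exact absurd hC h
        · rw [hz.unique _ hz']
          exact ⟨hne, h⟩
      · rw [exists_dominated_iff_of_not_isMulCommutative hη hζ hC]
        refine ⟨fun h => Or.inl ⟨⟨hC, h⟩, fun h' => hC h'.1⟩, ?_⟩
        rintro (⟨⟨-, h⟩, -⟩ | ⟨⟨h, -⟩, -⟩)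
        · exact h
        · exact absurd h hC
    · obtain ⟨j, e, he, hζe⟩ := exists_factor_of_not_isMulCommutative hη hζ hε hc hC
      have hker : (ε : fiberProd η →* E).ker = (fiberProdProj η j : fiberProd η →* H j).ker := by
        ext x
        change ε x = 1 ↔ fiberProdProj η j x = 1
        rw [← he, map_eq_one_iff e e.injective]
      have huniq : ∀ i, (ε : fiberProd η →* E).ker =
          (fiberProdProj η i : fiberProd η →* H i).ker → i = j :=
        fun i hi => fiberProdProj_ker_injective hη (hi.symm.trans hker).le
      refine ⟨⟨j, hker, huniq⟩, fun i hi => ?_⟩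
      obtain rfl := huniq i hi
      exact ⟨⟨e, hζe⟩, e, he, hζe⟩
    · exact exists_factor_kerIndex hη hζ hε hc (KerEquiv.refl (ζ : E →* G) hζ.surjective)
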